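/- **Setting.** Let $N_+,N_-\ge 1$, let $0\le m<n\le N_-$ be integers, and let $s_{ij}:\mathbb R^d\to\mathbb R$ ($1\le i\le N_+$, $1\le j\le N_-$) be differentiable with $\|\nabla s_{ij}(w)-\nabla s_{ij}(v)\|\le L\|w-v\|$ and $\|\nabla s_{ij}(w)\|\le B$ for all $w,v$, where $L,B\ge 0$. Let $\phi_l(S)$ be the sum of the $l$ largest coordinates of a vector $S$, let $f^l(w)=\sum_{i=1}^{N_+}\phi_l\big((s_{ij}(w))_{j=1}^{N_-}\big)$ and $F=f^n-f^m$, and assume $F^*=\inf F>-\infty$. Put $\rho=N_+N_-L$ and let $\mu>0$ with $\mu^{-1}>\rho$. Let $v_{\mu f}(w)$ be the minimizer of $u\mapsto f(u)+\frac1{2\mu}\|u-w\|^2$; let $g^l(v,\lambda)=l\sum_i\lambda_i+\sum_{i,j}[s_{ij}(v)-\lambda_i]_+$ for $\lambda\in\mathbb R^{N_+}$, and $\Lambda^*_l(w)=\arg\min_\lambda g^l(v_{\mu f^l}(w),\lambda)$. Let $\partial f(w)$ be the set of $\xi$ with $f(v)\ge f(w)+\langle\xi,v-w\rangle+o(\|v-w\|)$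 as $v\to w$. A random vector $x$ is *nearly $\epsilon$-critical* if there are random vectors $\xi,w',w''$ with $\xi\in\partial f^n(w')-\partial f^m(w'')$ almost surely and $\max\{\mathbb E\|\xi\|,\mathbb E\|x-w'\|,\mathbb E\|x-w''\|\}\le\epsilon$. **SBCD** (inner method, for given $w,\lambda,T,l$, step sizes $\eta,\theta$, sample sizes $1\le I\le N_+$, $1\le J\le N_-$): start at $(v^{(0)},\lambda^{(0)})=(w,\lambda)$. For $t=0,\dots,T-1$ draw independent uniform $\mathcal I_t\subset\{1,\dots,N_+\}$, $\mathcal J_t\subset\{1,\dots,N_-\}$ with $|\mathcal I_t|=I$, $|\mathcal J_t|=J$; with $G_v=\frac{N_+N_-}{IJ}\sum_{i\in\mathcal I_t,j\in\mathcal J_t}\nabla s_{ij}(v^{(t)})\mathbf 1(s_{ij}(v^{(t)})>\lambda^{(t)}_i)$ put $v^{(t+1)}=\arg\min_v\langle G_v,v\rangle+\frac{\|v-w\|^2}{2\mu}+\frac{\|v-v^{(t)}\|^2}{2\eta}$ (and $v^{(t+1)}=v^{(t)}$ if $\eta=0$); for $i\in\mathcal I_t$ put $\lambda^{(t+1)}_i=\lambda^{(t)}_i-\theta\big(l-\frac{N_-}{J}\sum_{j\in\mathcal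 J_t}\mathbf 1(s_{ij}(v^{(t)})>\lambda^{(t)}_i)\big)$, and $\lambda^{(t+1)}_i=\lambda^{(t)}_i$ for $i\notin\mathcal I_t$. The output is $\frac1T\sum_{t<T}(v^{(t)},\lambda^{(t)})$. **AGD** (outer method): given $w^{(0)},\bar\lambda^{(0)}_m,\bar\lambda^{(0)}_n$ and $\gamma>0$, for $k=0,1,\dots,K-1$ and $l=m,n$ let $(\bar v^{(k)}_l,\bar\lambda^{(k+1)}_l)$ be the output of SBCD for $(w^{(k)},\bar\lambda^{(k)}_l,T_k^l,l)$, with fresh independent samples, and let $w^{(k+1)}=w^{(k)}-\gamma\mu^{-1}(\bar v^{(k)}_m-\bar v^{(k)}_n)$. The output is $\bar v^{(\bar k)}_n$ with $\bar k$ uniform on $\{0,\dots,K-1\}$, independent of all samples. This is approximate gradient descent for $F^\mu=f^n_\mu-f^m_\mu$, the difference of the Moreau envelopes of $f^n$ and $f^m$. **Parameters.** $0<\gamma\le 1/L_\mu$ with $L_\mu=\frac{2}{\mu-\mu^2\rho}$; in outer iteration $k$, $\theta=\frac{\mathrm{dist}(\bar\lambda_l^{(k)},\Lambda^*_l(w^{(k)}))}{\sqrt{IT_k^l}\,N_-}$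 and $\eta=\frac{\|v_{\mu f^l}(w^{(k)})-w^{(k)}\|}{N_+N_-B\sqrt{T_k^l}}$ ($\eta=0$ if $B=0$); $$T_k^l=\left\lceil\max\left\{\frac{144N_+^2N_-^2D_l^2(k+1)^2}{I(\mu^{-1}-\rho)^2},\ \frac{16N_+^2N_-^2\mu^2(N_+lB)^2B^2(k+1)^2}{(\mu^{-1}-\rho)^2},\ \frac{6\mu(N_+lB)^2(k+1)}{2(\mu^{-1}-\rho)}\right\}\right\rceil,$$ $$D_l=\max\left\{\mathrm{dist}(\bar\lambda_l^{(0)},\Lambda_l^*(w^{(0)})),\ \tfrac12\big(\tfrac1\mu-\rho\big)+\tfrac{\mu(N_+lB)^2}{2}+N_+B+\tfrac{N_+B}{1-\mu\rho}\Big(\tfrac{2\gamma}{\mu}+\gamma N_+nB+\gamma N_+mB\Big)\right\}.$$ **Theorem.** The minimizers $v_{\mu f^l}(w)$ exist and are unique, and the sets $\Lambda^*_l(w)$ are nonempty. For every $\epsilon>0$, let $K(\epsilon)$ be the least positive integer that is at least $$\max\left\{\frac{16\mu^2}{\gamma\min\{1,\mu^2\}\epsilon^2}\big(F(v_{\mu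 f^m}(w^{(0)}))-F^*\big),\ \frac{96}{\min\{1,\mu^2\}\epsilon^2}\log\frac{96}{\min\{1,\mu^2\}\epsilon^2}\right\}.$$ Then for $K=K(\epsilon)$, and for every larger $K$, the output $\bar v_n^{(\bar k)}$ is nearly $\epsilon$-critical. Moreover $T_k^l=\Theta((k+1)^2)$ for $l=m,n$ as $k\to\infty$, and with all other data fixed, as $\epsilon\to0^+$, $K(\epsilon)=O(\epsilon^{-2}\log(1/\epsilon))=\tilde O(\epsilon^{-2})$, and the total number of inner iterations is $\sum_{k<K(\epsilon)}(T_k^m+T_k^n)=O(\epsilon^{-6}\log^3(1/\epsilon))=\tilde O(\epsilon^{-6})$. -/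

import Mathlib

open scoped Topology
open Filter MeasureTheory ProbabilityTheory Asymptotics

noncomputable section

namespace PAUC

/-- `ℝ^d` with the Euclidean norm. -/
abbrev Vec (d : ℕ) := EuclideanSpace ℝ (Fin d)

/-! ### The optimization problem -/

/-- `φ_l(S)`: the sum of the `l` largest coordinates of `S`. The permutation
`Tuple.sort (-S)` lists the indices of `S` in non-increasing order of the coordinates. -/
def topSum {N : ℕ} (l : ℕ) (S : Fin N → ℝ) : ℝ :=
  ∑ j ∈ (Finset.univ : Finset (Fin N)).filter (fun j : Fin N => j.val < l),
    S (Tuple.sort (fun i => -S i) j)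

/-- `f^l(w) = ∑_i φ_l(S_i(w))`, where `S_i(w) = (s_ij(w))_j`. -/
def fTop {d Np Nm : ℕ} (s : Fin Np → Fin Nm → Vec d → ℝ) (l : ℕ) (w : Vec d) : ℝ :=
  ∑ i, topSum l (fun j => s i j w)

/-- The objective `F = f^n - f^m`. -/
def objF {d Np Nm : ℕ} (s : Fin Np → Fin Nm → Vec d → ℝ) (m n : ℕ) (w : Vec d) : ℝ :=
  fTop s n w - fTop s m w

/-- `F^* = inf F`. -/
def Fstar {d Np Nm : ℕ} (s : Fin Np → Fin Nm → Vec d → ℝ) (m n : ℕ) : ℝ :=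
  ⨅ w : Vec d, objF s m n w

/-- The standing assumption: every `s_ij` is differentiable with an `L`-Lipschitz gradient that is
bounded by `B`, and `F` is bounded below. -/
structure SmoothLosses {d Np Nm : ℕ} (s : Fin Np → Fin Nm → Vec d → ℝ) (m n : ℕ) (L B : ℝ) :
    Prop where
  L_nonneg : 0 ≤ L
  B_nonneg : 0 ≤ B
  differentiable : ∀ i j, Differentiable ℝ (s i j)
  grad_lipschitz : ∀ i j (w v : Vec d),
    ‖gradient (s i j) w - gradient (s i j) v‖ ≤ L * ‖w - v‖
  grad_bounded : ∀ i j (w : Vec d), ‖gradient (s i j) w‖ ≤ B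
  bddBelow : BddBelow (Set.range (objF s m n))

/-! ### Subdifferential, nearly critical points, proximal mapping -/

/-- `∂f(w)`: all `ξ` with `f(v) ≥ f(w) + ⟨ξ, v - w⟩ + o(‖v - w‖)` as `v → w`. -/
def subdiff {d : ℕ} (f : Vec d → ℝ) (w : Vec d) : Set (Vec d) :=
  {ξ | ∀ δ : ℝ, 0 < δ →
    ∀ᶠ v in 𝓝 w, f w + inner ℝ ξ (v - w) - δ * ‖v - w‖ ≤ f v}

/-- A random vector `x` is a nearly `ε`-critical point of `min (f - h)`: there are random vectors
`ξ, w', w''` with `ξ ∈ ∂f(w') - ∂h(w'')` almost surely and with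
`E‖ξ‖`, `E‖x - w'‖`, `E‖x - w''‖` at most `ε`. -/
def NearlyCritical {d : ℕ} {Ω : Type*} [MeasurableSpace Ω] (P : Measure Ω)
    (f h : Vec d → ℝ) (ε : ℝ) (x : Ω → Vec d) : Prop :=
  ∃ ξ w' w'' : Ω → Vec d,
    (∀ᵐ ω ∂P, ∃ a ∈ subdiff f (w' ω), ∃ b ∈ subdiff h (w'' ω), ξ ω = a - b) ∧
    Integrable ξ P ∧
    Integrable (fun ω => x ω - w' ω) P ∧
    Integrable (fun ω => x ω - w'' ω) P ∧
    ∫ ω, ‖ξ ω‖ ∂P ≤ ε ∧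
    ∫ ω, ‖x ω - w' ω‖ ∂P ≤ ε ∧
    ∫ ω, ‖x ω - w'' ω‖ ∂P ≤ ε

/-- `v` minimizes `u ↦ f(u) + ‖u - w‖² / (2μ)`. -/
def IsProx {d : ℕ} (μ : ℝ) (f : Vec d → ℝ) (w v : Vec d) : Prop :=
  ∀ u, f v + ‖v - w‖ ^ 2 / (2 * μ) ≤ f u + ‖u - w‖ ^ 2 / (2 * μ)

/-- The proximal mapping `v_{μ f}(w)`, the minimizer of `u ↦ f(u) + ‖u - w‖² / (2μ)`. -/
def prox {d : ℕ} (μ : ℝ) (f : Vec d → ℝ) (w : Vec d) : Vec d :=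
  Classical.epsilon (IsProx μ f w)

/-- `g^l(v, λ) = l ∑_i λ_i + ∑_i ∑_j [s_ij(v) - λ_i]_+`. -/
def gFun {d Np Nm : ℕ} (s : Fin Np → Fin Nm → Vec d → ℝ) (l : ℕ) (v : Vec d) (lam : Vec Np) : ℝ :=
  l * (∑ i, lam i) + ∑ i, ∑ j, max (s i j v - lam i) 0

/-- `argmin_λ g^l(v, λ)`. -/
def lamArgmin {d Np Nm : ℕ} (s : Fin Np → Fin Nm → Vec d → ℝ) (l : ℕ) (v : Vec d) : Set (Vec Np) :=
  {lam | ∀ lam', gFun s l v lam ≤ gFun s l v lam'}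

/-! ### Stochastic block coordinate descent (SBCD) -/

/-- One draw of the index sets: `rows = 𝓘_t`, `cols = 𝓙_t`. -/
@[ext]
structure Sample (Np Nm : ℕ) where
  rows : Finset (Fin Np)
  cols : Finset (Fin Nm)

instance (Np Nm : ℕ) : MeasurableSpace (Sample Np Nm) := ⊤

/-- The stochastic subgradient `G_v`. -/
def gradV {d Np Nm : ℕ} (s : Fin Np → Fin Nm → Vec d → ℝ) (I J : ℕ) (z : Sample Np Nm)
    (v : Vec d) (lam : Vec Np) : Vec d :=
  ((Np * Nm : ℝ) / (I * J)) •
    ∑ i ∈ z.rows, ∑ j ∈ z.cols, if lam i < s i j v then gradient (s i j) v else 0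

/-- The stochastic subgradient `G_{λ_i}`. -/
def gradLam {d Np Nm : ℕ} (s : Fin Np → Fin Nm → Vec d → ℝ) (J l : ℕ) (z : Sample Np Nm)
    (v : Vec d) (lam : Vec Np) (i : Fin Np) : ℝ :=
  l - (Nm : ℝ) / J * ∑ j ∈ z.cols, if lam i < s i j v then (1 : ℝ) else 0

/-- The proximal update `argmin_u ⟨G, u⟩ + ‖u - w‖² / (2μ) + ‖u - v‖² / (2η)` in closed form
(see `proxStep_spec`). For `η = 0` it is `v`, the limit as `η → 0`. -/
def proxStep {d : ℕ} (μ η : ℝ) (w v G : Vec d) : Vec d :=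
  (μ + η)⁻¹ • (μ • v + η • w - (μ * η) • G)

/-- For `μ, η > 0`, `proxStep` is the unique minimizer of the objective of the proximal update. -/
theorem proxStep_spec {d : ℕ} {μ η : ℝ} (hμ : 0 < μ) (hη : 0 < η) (w v G u : Vec d) :
    inner ℝ G u + ‖u - w‖ ^ 2 / (2 * μ) + ‖u - v‖ ^ 2 / (2 * η) =
      inner ℝ G (proxStep μ η w v G) + ‖proxStep μ η w v G - w‖ ^ 2 / (2 * μ)
        + ‖proxStep μ η w v G - v‖ ^ 2 / (2 * η)
        + (1 / (2 * μ) + 1 / (2 * η)) * ‖u - proxStep μ η w v G‖ ^ 2 := by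
  have hs : μ + η ≠ 0 := by positivity
  simp only [EuclideanSpace.norm_sq_eq, PiLp.inner_apply, proxStep, Real.norm_eq_abs, sq_abs,
    Finset.sum_div, Finset.mul_sum, ← Finset.sum_add_distrib]
  refine Finset.sum_congr rfl fun i _ => ?_
  simp only [PiLp.sub_apply, PiLp.smul_apply, PiLp.add_apply, smul_eq_mul, RCLike.inner_apply,
    conj_trivial]
  field_simp
  ring

/-- One iteration of SBCD for `min_{v, λ} g^l(v, λ) + ‖v - w‖² / (2μ)` with step sizes `η` (for
`v`) and `θ` (for `λ`). -/
def sbcdStep {d Np Nm : ℕ} (s : Fin Np → Fin Nm → Vec d → ℝ) (I J l : ℕ) (μ η θ : ℝ) (w : Vec d)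
    (z : Sample Np Nm) (x : Vec d × Vec Np) : Vec d × Vec Np :=
  (proxStep μ η w x.1 (gradV s I J z x.1 x.2),
    WithLp.toLp 2 fun i =>
      if i ∈ z.rows then x.2 i - θ * gradLam s J l z x.1 x.2 i else x.2 i)

/-- The iterates `(v^(t), λ^(t))` of SBCD started at `(w, lam)`; `z t` is the draw of step `t`. -/
def sbcdIter {d Np Nm : ℕ} (s : Fin Np → Fin Nm → Vec d → ℝ) (I J l : ℕ) (μ η θ : ℝ) (w : Vec d)
    (lam : Vec Np) (z : ℕ → Sample Np Nm) : ℕ → Vec d × Vec Np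
  | 0 => (w, lam)
  | t + 1 => sbcdStep s I J l μ η θ w (z t) (sbcdIter s I J l μ η θ w lam z t)

/-- The output `(1/T) ∑_{t < T} (v^(t), λ^(t))` of SBCD. -/
def sbcd {d Np Nm : ℕ} (s : Fin Np → Fin Nm → Vec d → ℝ) (I J l : ℕ) (μ η θ : ℝ) (w : Vec d)
    (lam : Vec Np) (T : ℕ) (z : ℕ → Sample Np Nm) : Vec d × Vec Np :=
  (T : ℝ)⁻¹ • ∑ t ∈ Finset.range T, sbcdIter s I J l μ η θ w lam z t

/-! ### Approximate gradient descent (AGD) with SBCD as inner solver -/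

/-- The data of a run: the losses `s_ij`, the range `m, n`, the sample sizes `I, J`, the constants
`L, B`, the smoothing parameter `μ`, the step size `γ`, and the initial points. Where a `Bool` selects
one of the two inner problems, `false` stands for `l = m` and `true` for `l = n`. -/
structure Setup (d Np Nm : ℕ) where
  s : Fin Np → Fin Nm → Vec d → ℝ
  m : ℕ
  n : ℕ
  I : ℕ
  J : ℕ
  L : ℝ
  B : ℝ
  μ : ℝ
  γ : ℝ
  w0 : Vec d
  lam0 : Bool → Vec Np

namespace Setup

variable {d Np Nm : ℕ} (S : Setup d Np Nm)

/-- The index `l` of an inner problem. -/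
def lev (b : Bool) : ℕ := if b then S.n else S.m

/-- `ρ = N₊ N₋ L`. -/
def ρ : ℝ := Np * Nm * S.L

/-- `L_μ = 2 / (μ - μ² ρ)`, the Lipschitz constant of the gradient of the smoothed objective. -/
def Lmu : ℝ := 2 / (S.μ - S.μ ^ 2 * S.ρ)

/-- `v_{μ f^l}(w)`. -/
def proxL (b : Bool) (w : Vec d) : Vec d := prox S.μ (fTop S.s (S.lev b)) w

/-- The distance of `lam` to `Λ^* = argmin_λ g^l(v_{μ f^l}(w), λ)`. -/
def distLam (b : Bool) (w : Vec d) (lam : Vec Np) : ℝ :=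
  Metric.infDist lam (lamArgmin S.s (S.lev b) (S.proxL b w))

/-- The constant `D_l`. -/
def D (b : Bool) : ℝ :=
  max (S.distLam b S.w0 (S.lam0 b))
    (1 / 2 * (1 / S.μ - S.ρ) + S.μ * (Np * S.lev b * S.B) ^ 2 / 2 + Np * S.B
      + Np * S.B / (1 - S.μ * S.ρ)
        * (2 * S.γ / S.μ + S.γ * (Np * S.n * S.B) + S.γ * (Np * S.m * S.B)))

/-- The number `T_k` of SBCD iterations for the inner problem `l` in outer iteration `k`. -/
def T (b : Bool) (k : ℕ) : ℕ :=
  ⌈max (max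
      (144 * Np ^ 2 * Nm ^ 2 * S.D b ^ 2 * ((k : ℝ) + 1) ^ 2 / (S.I * (S.μ⁻¹ - S.ρ) ^ 2))
      (16 * Np ^ 2 * Nm ^ 2 * S.μ ^ 2 * (Np * S.lev b * S.B) ^ 2 * S.B ^ 2 * ((k : ℝ) + 1) ^ 2
        / (S.μ⁻¹ - S.ρ) ^ 2))
      (6 * S.μ * (Np * S.lev b * S.B) ^ 2 * ((k : ℝ) + 1) / (2 * (S.μ⁻¹ - S.ρ)))⌉₊

/-- The step size `θ` for `λ` in outer iteration `k`, for the current points `w`, `lam`. -/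
def stepθ (b : Bool) (k : ℕ) (w : Vec d) (lam : Vec Np) : ℝ :=
  S.distLam b w lam / (√(S.I * S.T b k) * Nm)

/-- The step size `η` for `v` in outer iteration `k`, for the current point `w`. -/
def stepη (b : Bool) (k : ℕ) (w : Vec d) : ℝ :=
  ‖S.proxL b w - w‖ / (Np * Nm * S.B * √(S.T b k))

/-- The call of SBCD for the inner problem `l` in outer iteration `k`. -/
def innerCall (b : Bool) (k : ℕ) (w : Vec d) (lam : Vec Np) (z : ℕ → Sample Np Nm) :
    Vec d × Vec Np :=
  sbcd S.s S.I S.J (S.lev b) S.μ (S.stepη b k w) (S.stepθ b k w lam) w lam (S.T b k) z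

/-- The state `(w^(k), (λ_m^(k), λ_n^(k)))` of AGD before outer iteration `k`;
`z (k, b, t)` is the draw of SBCD step `t` of the call for the inner problem `b` in iteration `k`. -/
def agd (z : ℕ × Bool × ℕ → Sample Np Nm) : ℕ → Vec d × (Bool → Vec Np)
  | 0 => (S.w0, S.lam0)
  | k + 1 =>
    let x := agd z k
    let out := fun b : Bool => S.innerCall b k x.1 (x.2 b) (fun t => z (k, b, t))
    (x.1 - (S.γ * S.μ⁻¹) • ((out false).1 - (out true).1), fun b => (out b).2)

/-- The output `v̄_l^(k)` of the SBCD call for the inner problem `l` in outer iteration `k`. -/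
def vbar (b : Bool) (z : ℕ × Bool × ℕ → Sample Np Nm) (k : ℕ) : Vec d :=
  (S.innerCall b k (S.agd z k).1 ((S.agd z k).2 b) (fun t => z (k, b, t))).1

/-- The bound on the number of outer iterations. -/
def outerBound (ε : ℝ) : ℝ :=
  max (16 * S.μ ^ 2 / (S.γ * min 1 (S.μ ^ 2) * ε ^ 2)
      * (objF S.s S.m S.n (S.proxL false S.w0) - Fstar S.s S.m S.n))
    (96 / (min 1 (S.μ ^ 2) * ε ^ 2) * Real.log (96 / (min 1 (S.μ ^ 2) * ε ^ 2)))

/-- The number of outer iterations for accuracy `ε`: the least positive integer that is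
at least `outerBound ε`. -/
def outerIters (ε : ℝ) : ℕ := max 1 ⌈S.outerBound ε⌉₊

/-- The total number of SBCD iterations, over both calls in each of `K` outer iterations. -/
def totalInner (K : ℕ) : ℕ := ∑ k ∈ Finset.range K, (S.T false k + S.T true k)

end Setup

/-- The draws `Z (k, b, t)` are independent, and each one is a pair of independent uniformly
distributed subsets of sizes `I` and `J`. -/
structure UniformDraws {Np Nm : ℕ} {Ω : Type*} [MeasurableSpace Ω] (P : Measure Ω) (I J : ℕ)
    (Z : ℕ × Bool × ℕ → Ω → Sample Np Nm) : Prop where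
  measurable : ∀ q, Measurable (Z q)
  indep : iIndepFun Z P
  uniform : ∀ q (A : Finset (Fin Np)) (C : Finset (Fin Nm)), A.card = I → C.card = J →
    P.real {ω | Z q ω = ⟨A, C⟩} = 1 / (Np.choose I * Nm.choose J : ℝ)

/-- `κ` is uniformly distributed on `{0, …, K - 1}` and independent of all draws. -/
structure UniformIndex {Np Nm : ℕ} {Ω : Type*} [MeasurableSpace Ω] (P : Measure Ω)
    (Z : ℕ × Bool × ℕ → Ω → Sample Np Nm) (K : ℕ) (κ : Ω → ℕ) : Prop where
  measurable : Measurable κ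
  indep : IndepFun κ (fun ω q => Z q ω) P
  uniform : ∀ k < K, P.real {ω | κ ω = k} = 1 / (K : ℝ)

end PAUC

end

/-! The sum of the `l` largest coordinates of `S` is the minimum over `x` of `l * x + ∑ j, max (S j
- x) 0`. Hence `f^l(v)` is the minimum of `g^l(v, ·)`, and the proximal problem for `f^l` is a joint
minimization in `(v, λ)`, convex because `ρ < μ⁻¹`.

Each `f^l` is `ρ`-weakly convex and `N₊ l B`-Lipschitz. Write `p_l(w)` for its proximal point. The
vector `μ⁻¹ (w - p_l(w))` is a subgradient of `f^l` at `p_l(w)` and also the gradient of the Moreau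
envelope at `w`, with quadratic bounds on both sides. So `∇F^μ(w) = μ⁻¹ (p_m(w) - p_n(w))` lies in
`∂f^n(p_n(w)) - ∂f^m(p_m(w))`. Where it is small, the two proximal points are also close to each
other, and a good approximation of `p_n(w)` is nearly critical.

Inner loop: a Lyapunov function built from squared distances to the exact solution decreases in
expectation by the suboptimality, up to step-size noise (`sbcdStep_descent`). With the prescribed
steps and `T_k`, the averaged output has expected gap at most `(μ⁻¹ - ρ) / (2 (k + 1))`, provided
that the initial dual distance has mean at most `D_l`. By strong convexity the squared primal error
then has mean at most `1 / (k + 1)` (`integral_err_sq_le`).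

The proviso is proved by induction over `k` (`integral_dualDist_le`). The one-dimensional
minimization is sharp: the distance of `x` to the minimizers is at most its suboptimality, stably
under perturbation of `S` (`exists_hinge_eq_near`). A small gap and a short outer step therefore
keep the warm-started dual variable close to the next set of minimizers.

Outer loop: gradient descent on `F^μ` with squared gradient errors `O(1 / (k + 1))` bounds the
average of `‖∇F^μ‖²` by `O((1 + log K) / K)`. The choice of `K` makes this a multiple of `ε²`, and
summing `T_k = Θ((k + 1)²)` gives a total of order `K³`. -/

noncomputable section

namespace PAUC

/-! ### Sums of the largest coordinates -/

/-- The one-dimensional function `x ↦ l x + ∑_j [S_j - x]_+`, whose minimum is `φ_l(S)`. -/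
def hinge {N : ℕ} (l : ℕ) (S : Fin N → ℝ) (x : ℝ) : ℝ := l * x + ∑ j, max (S j - x) 0

theorem antitone_comp_sort {N : ℕ} (S : Fin N → ℝ) {i j : Fin N} (h : i ≤ j) :
    S (Tuple.sort (fun i => -S i) j) ≤ S (Tuple.sort (fun i => -S i) i) := by
  have := Tuple.monotone_sort (fun i => -S i) h
  simpa using this

theorem card_filter_val_lt {N l : ℕ} (hl : l ≤ N) :
    ((Finset.univ : Finset (Fin N)).filter (fun j : Fin N => j.val < l)).card = l := by
  rw [Fin.card_filter_val_lt]
  omega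

theorem exists_topSum_eq {N : ℕ} {l : ℕ} (hl : l ≤ N) (S : Fin N → ℝ) :
    ∃ A : Finset (Fin N), A.card = l ∧ topSum l S = ∑ j ∈ A, S j := by
  refine ⟨((Finset.univ : Finset (Fin N)).filter (fun j : Fin N => j.val < l)).map
    (Tuple.sort (fun i => -S i)).toEmbedding, ?_, ?_⟩
  · rw [Finset.card_map, card_filter_val_lt hl]
  · simp [topSum]

/-- Drop the terms outside `A` and bound `S j - x` by its positive part. Sets with `A.card ≠ l` are
allowed because the slope `l - A.card` is what later shows sharpness. -/
theorem sum_add_le_hinge {N : ℕ} (l : ℕ) (S : Fin N → ℝ) (A : Finset (Fin N)) (x : ℝ) :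
    ∑ j ∈ A, S j + ((l : ℝ) - A.card) * x ≤ hinge l S x := by
  have h1 : ∑ j ∈ A, (S j - x) ≤ ∑ j, max (S j - x) 0 :=
    (Finset.sum_le_sum fun j _ => le_max_left _ _).trans
      (Finset.sum_le_sum_of_subset_of_nonneg (Finset.subset_univ A)
        fun _ _ _ => le_max_right _ _)
  rw [Finset.sum_sub_distrib, Finset.sum_const, nsmul_eq_mul] at h1
  unfold hinge
  linarith

theorem topSum_add_le_hinge {N : ℕ} (l : ℕ) {l' : ℕ} (hl : l' ≤ N) (S : Fin N → ℝ) (x : ℝ) :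
    topSum l' S + ((l : ℝ) - l') * x ≤ hinge l S x := by
  obtain ⟨A, hA, h⟩ := exists_topSum_eq hl S
  have := sum_add_le_hinge l S A x
  rwa [hA, ← h] at this

theorem topSum_le_hinge {N l : ℕ} (hl : l ≤ N) (S : Fin N → ℝ) (x : ℝ) :
    topSum l S ≤ hinge l S x := by
  simpa using topSum_add_le_hinge l hl S x

theorem topSum_succ {N l : ℕ} (hl : l < N) (S : Fin N → ℝ) :
    topSum (l + 1) S = topSum l S + S (Tuple.sort (fun i => -S i) ⟨l, hl⟩) := by
  have : (Finset.univ : Finset (Fin N)).filter (fun j : Fin N => j.val < l + 1)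
      = insert ⟨l, hl⟩ ((Finset.univ : Finset (Fin N)).filter (fun j : Fin N => j.val < l)) := by
    ext j
    simp only [Finset.mem_filter, Finset.mem_univ, true_and, Finset.mem_insert, Fin.ext_iff]
    omega
  unfold topSum
  rw [this, Finset.sum_insert (by simp), add_comm]

/-- Only the `l` leading positive parts can be nonzero, and `l * x` cancels the copies of `x` in
them. -/
theorem hinge_eq_topSum_of_between {N l : ℕ} (hl : l ≤ N) (S : Fin N → ℝ) {x : ℝ}
    (h1 : ∀ j : Fin N, j.val < l → x ≤ S (Tuple.sort (fun i => -S i) j))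
    (h2 : ∀ j : Fin N, l ≤ j.val → S (Tuple.sort (fun i => -S i) j) ≤ x) :
    hinge l S x = topSum l S := by
  have h3 : ∑ j, max (S j - x) 0
      = ∑ j : Fin N, if j.val < l then S (Tuple.sort (fun i => -S i) j) - x else 0 := by
    rw [← Equiv.sum_comp (Tuple.sort (fun i => -S i))]
    refine Finset.sum_congr rfl fun j _ => ?_
    split_ifs with hj
    · exact max_eq_left (sub_nonneg.2 (h1 j hj))
    · exact max_eq_right (sub_nonpos.2 (h2 j (not_lt.1 hj)))
  unfold hinge topSum
  rw [h3, ← Finset.sum_filter, Finset.sum_sub_distrib, Finset.sum_const, nsmul_eq_mul,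
    card_filter_val_lt hl]
  ring

/-- The order statistics are monotone, and stable under uniform perturbations. -/
theorem orderStat_le_add {N : ℕ} {S S' : Fin N → ℝ} {δ : ℝ} (h : ∀ j, S j ≤ S' j + δ) (k : Fin N) :
    S (Tuple.sort (fun i => -S i) k) ≤ S' (Tuple.sort (fun i => -S' i) k) + δ := by
  set σ := Tuple.sort (fun i => -S i) with hσ
  set τ := Tuple.sort (fun i => -S' i) with hτ
  -- Pigeonhole: the `k + 1` leading indices for `S` cannot all have rank below `k` for `S'`.
  obtain ⟨j, hj, hkj⟩ : ∃ j ≤ k, k ≤ τ.symm (σ j) := by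
    by_contra! hcon
    have := Finset.card_le_card_of_injOn (s := Finset.Iic k) (t := Finset.Iio k)
      (fun j => τ.symm (σ j)) (fun j hj => by simpa using hcon j (by simpa using hj))
      (fun a _ b _ hab => σ.injective (τ.symm.injective hab))
    simp at this
  calc S (σ k) ≤ S (σ j) := antitone_comp_sort S hj
    _ ≤ S' (τ (τ.symm (σ j))) + δ := by simpa using h (σ j)
    _ ≤ S' (τ k) + δ := by gcongr; exact antitone_comp_sort S' hkj

/-- Sharpness of the minimizers of `hinge`, combined with their stability: up to the perturbation
size, the distance of `x` to the minimizers is bounded by the suboptimality of `x`. -/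
theorem exists_hinge_eq_near {N l : ℕ} (hl : l ≤ N) {S S' : Fin N → ℝ} {δ : ℝ}
    (h0 : 0 ≤ δ) (h : ∀ j, |S j - S' j| ≤ δ) (x : ℝ) :
    ∃ x', hinge l S' x' = topSum l S' ∧ |x - x'| ≤ hinge l S x - topSum l S + δ := by
  have hle : ∀ j, S j ≤ S' j + δ := fun j => by linarith [(abs_le.1 (h j)).2]
  have hle' : ∀ j, S' j ≤ S j + δ := fun j => by linarith [(abs_le.1 (h j)).1]
  -- The minimizers for `S'` form the interval between its order statistics of 0-based ranks `l` and
  -- `l - 1`, unbounded if `l = N` or `l = 0`. If `x` lies outside, the nearer endpoint serves as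
  -- `x'`.
  by_cases hA : ∃ k, ∃ hk : k < N, l = k + 1 ∧ S' (Tuple.sort (fun i => -S' i) ⟨k, hk⟩) < x
  · obtain ⟨k, hk, rfl, hx⟩ := hA
    refine ⟨S' (Tuple.sort (fun i => -S' i) ⟨k, hk⟩), ?_, ?_⟩
    · refine hinge_eq_topSum_of_between hl S' (fun j hj => antitone_comp_sort S' ?_)
        (fun j hj => antitone_comp_sort S' ?_)
      · exact Fin.le_def.2 (Nat.lt_succ_iff.1 hj)
      · exact Fin.le_def.2 (Nat.le_of_succ_le hj)
    · rw [abs_of_pos (sub_pos.2 hx)]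
      have h1 := orderStat_le_add hle ⟨k, hk⟩
      -- The bound with one coordinate fewer has slope `1`, which controls `x` to the right of the
      -- interval.
      have h2 := topSum_add_le_hinge (k + 1) hk.le S x
      have h3 := topSum_succ hk S
      push_cast at h2
      linarith
  by_cases hB : ∃ hk : l < N, x < S' (Tuple.sort (fun i => -S' i) ⟨l, hk⟩)
  · obtain ⟨hk, hx⟩ := hB
    refine ⟨S' (Tuple.sort (fun i => -S' i) ⟨l, hk⟩), ?_, ?_⟩
    · refine hinge_eq_topSum_of_between hl S' (fun j hj => antitone_comp_sort S' ?_)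
        (fun j hj => antitone_comp_sort S' ?_)
      · exact Fin.le_def.2 hj.le
      · exact Fin.le_def.2 hj
    · rw [abs_of_neg (sub_neg.2 hx)]
      have h1 := orderStat_le_add hle' ⟨l, hk⟩
      -- One coordinate more gives slope `-1`, for `x` to the left.
      have h2 := topSum_add_le_hinge l (Nat.succ_le_of_lt hk) S x
      have h3 := topSum_succ hk S
      push_cast at h2
      linarith
  · push Not at hA hB
    refine ⟨x, hinge_eq_topSum_of_between hl S' (fun j hj => ?_) (fun j hj => ?_), ?_⟩
    · obtain ⟨k, rfl⟩ : ∃ k, l = k + 1 := ⟨l - 1, by omega⟩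
      exact (hA k hl rfl).trans (antitone_comp_sort S' (Fin.le_def.2 (Nat.lt_succ_iff.1 hj)))
    · exact (antitone_comp_sort S' (Fin.le_def.2 hj)).trans (hB (hj.trans_lt j.2))
    · have := topSum_le_hinge hl S x
      simp only [sub_self, abs_zero]
      linarith

theorem exists_hinge_eq {N l : ℕ} (hl : l ≤ N) (S : Fin N → ℝ) : ∃ x, hinge l S x = topSum l S :=
  (exists_hinge_eq_near hl (S := S) (S' := S) le_rfl (by simp) 0).imp fun _ h => h.1

/-- The lower bound for `A` is evaluated at a minimizing `x`; no rearrangement is needed. -/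
theorem sum_le_topSum {N : ℕ} (S : Fin N → ℝ) (A : Finset (Fin N)) :
    ∑ j ∈ A, S j ≤ topSum A.card S := by
  obtain ⟨x, hx⟩ := exists_hinge_eq (by simpa using A.card_le_univ) S
  simpa [hx] using sum_add_le_hinge A.card S A x

theorem topSum_le_add {N l : ℕ} (hl : l ≤ N) {S S' : Fin N → ℝ} {δ : ℝ}
    (h : ∀ j, S j ≤ S' j + δ) : topSum l S ≤ topSum l S' + l * δ := by
  obtain ⟨A, hA, hS⟩ := exists_topSum_eq hl S
  have h1 := sum_le_topSum S' A
  have h2 : ∑ j ∈ A, S j ≤ ∑ j ∈ A, (S' j + δ) := Finset.sum_le_sum fun j _ => h j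
  rw [Finset.sum_add_distrib, Finset.sum_const, nsmul_eq_mul] at h2
  rw [hS, ← hA]
  linarith

/-- A set attaining `topSum l R` is a competitor for both `S` and `S'`. The additive `δ` carries the
weak-convexity defect of the losses. -/
theorem topSum_convex_combination_le {N l : ℕ} (hl : l ≤ N) {S S' R : Fin N → ℝ} {t δ : ℝ}
    (ht : 0 ≤ t) (ht' : t ≤ 1) (h : ∀ j, R j ≤ (1 - t) * S j + t * S' j + δ) :
    topSum l R ≤ (1 - t) * topSum l S + t * topSum l S' + l * δ := by
  obtain ⟨A, hA, hS⟩ := exists_topSum_eq hl R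
  have h1 := mul_le_mul_of_nonneg_left (sum_le_topSum S A) (sub_nonneg.2 ht')
  have h1' := mul_le_mul_of_nonneg_left (sum_le_topSum S' A) ht
  have h2 : ∑ j ∈ A, R j ≤ ∑ j ∈ A, ((1 - t) * S j + t * S' j + δ) :=
    Finset.sum_le_sum fun j _ => h j
  rw [Finset.sum_add_distrib, Finset.sum_add_distrib, ← Finset.mul_sum, ← Finset.mul_sum,
    Finset.sum_const, nsmul_eq_mul] at h2
  rw [hS, ← hA]
  linarith

/-! ### Functions with Lipschitz gradient -/

section Smooth

variable {E : Type*} [NormedAddCommGroup E] [InnerProductSpace ℝ E] [CompleteSpace E]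

/-- The quadratic lower bound for a function with `L`-Lipschitz gradient. -/
theorem quadratic_lower_bound {f : E → ℝ} {L : ℝ} (hf : Differentiable ℝ f)
    (hL : ∀ w v, ‖gradient f w - gradient f v‖ ≤ L * ‖w - v‖) (u v : E) :
    f v + inner ℝ (gradient f v) (u - v) - L / 2 * ‖u - v‖ ^ 2 ≤ f u := by
  -- On the segment, `f` minus its linearization plus the quadratic is nondecreasing; comparing `t =
  -- 0` with `t = 1` gives the claim.
  set φ : ℝ → ℝ := fun t => f (v + t • (u - v)) - t * inner ℝ (gradient f v) (u - v)
    + L / 2 * t ^ 2 * ‖u - v‖ ^ 2 with hφ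
  have hd : ∀ t, HasDerivAt φ (inner ℝ (gradient f (v + t • (u - v))) (u - v)
      - inner ℝ (gradient f v) (u - v) + L * t * ‖u - v‖ ^ 2) t := by
    intro t
    have h1 : HasDerivAt (fun t : ℝ => v + t • (u - v)) (u - v) t := by
      simpa using ((hasDerivAt_id t).smul_const (u - v)).const_add v
    have h2 := ((hf (v + t • (u - v))).hasGradientAt.hasFDerivAt).comp_hasDerivAt t h1
    have h3 := (h2.sub ((hasDerivAt_id t).mul_const (inner ℝ (gradient f v) (u - v)))).add
      ((((hasDerivAt_id t).pow 2).const_mul (L / 2)).mul_const (‖u - v‖ ^ 2))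
    refine h3.congr_deriv ?_
    simp only [InnerProductSpace.toDual_apply_apply, id_eq, Nat.cast_ofNat]
    ring
  have hmono : MonotoneOn φ (Set.Icc 0 1) := by
    refine monotoneOn_of_deriv_nonneg (convex_Icc 0 1)
      (fun t _ => (hd t).continuousAt.continuousWithinAt)
      (fun t _ => (hd t).differentiableAt.differentiableWithinAt) fun t ht => ?_
    rw [interior_Icc] at ht
    rw [(hd t).deriv, ← inner_sub_left]
    have h1 := abs_real_inner_le_norm (gradient f (v + t • (u - v)) - gradient f v) (u - v)
    have h2 := hL (v + t • (u - v)) v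
    rw [add_sub_cancel_left, norm_smul, Real.norm_eq_abs, abs_of_pos ht.1] at h2
    have h3 := mul_le_mul_of_nonneg_right h2 (norm_nonneg (u - v))
    nlinarith [(abs_le.1 h1).1]
  have := hmono (by simp) (by simp) zero_le_one
  simp only [hφ, zero_smul, one_smul, add_zero, add_sub_cancel, zero_mul, one_mul, one_pow,
    mul_one, ne_eq, OfNat.ofNat_ne_zero, not_false_eq_true, zero_pow, mul_zero, sub_zero] at this
  linarith

/-- A function with `L`-Lipschitz gradient is `L`-weakly convex. -/
theorem weakly_convex_of_lipschitz_gradient {f : E → ℝ} {L : ℝ} (hf : Differentiable ℝ f)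
    (hL : ∀ w v, ‖gradient f w - gradient f v‖ ≤ L * ‖w - v‖) (u v : E) {t : ℝ} (ht : 0 ≤ t)
    (ht' : t ≤ 1) :
    f (v + t • (u - v)) ≤ (1 - t) * f v + t * f u + t * (1 - t) * (L / 2) * ‖u - v‖ ^ 2 := by
  -- Both lower bounds are taken at the intermediate point, so that their gradient terms cancel in
  -- the convex combination.
  set x := v + t • (u - v) with hx
  have h1 := quadratic_lower_bound hf hL u x
  have h2 := quadratic_lower_bound hf hL v x
  have e1 : u - x = (1 - t) • (u - v) := by rw [hx]; module
  have e2 : v - x = (-t) • (u - v) := by rw [hx]; module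
  rw [e1, inner_smul_right, norm_smul, mul_pow, Real.norm_eq_abs, sq_abs] at h1
  rw [e2, inner_smul_right, norm_smul, mul_pow, Real.norm_eq_abs, sq_abs] at h2
  nlinarith [mul_le_mul_of_nonneg_left h1 ht, mul_le_mul_of_nonneg_left h2 (sub_nonneg.2 ht')]

theorem abs_sub_le_of_gradient_bounded {f : E → ℝ} {B : ℝ} (hf : Differentiable ℝ f)
    (hB : ∀ w, ‖gradient f w‖ ≤ B) (u v : E) : |f u - f v| ≤ B * ‖u - v‖ := by
  refine Convex.norm_image_sub_le_of_norm_fderiv_le (𝕜 := ℝ) (s := Set.univ)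
    (fun x _ => hf x) (fun x _ => ?_) convex_univ (Set.mem_univ v) (Set.mem_univ u)
  simpa only [gradient, LinearIsometryEquiv.norm_map] using hB x

end Smooth

/-- Stands in for the limit `t → 0` after a first-order comparison has been divided by `t`. -/
theorem nonpos_of_forall_le_mul {X C : ℝ} (hC : 0 ≤ C) (h : ∀ t : ℝ, 0 < t → t ≤ 1 → X ≤ t * C) :
    X ≤ 0 := by
  by_contra! hX
  have h1 := h (X / (X + C)) (by positivity) ((div_le_one (by positivity)).2 (by linarith))
  rw [div_mul_eq_mul_div, le_div_iff₀ (by positivity)] at h1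
  nlinarith

/-! ### Proximal mappings of weakly convex Lipschitz functions -/

/-- `f` is `ρ`-weakly convex and `M`-Lipschitz. -/
structure WeaklyConvexLipschitz {d : ℕ} (f : Vec d → ℝ) (ρ M : ℝ) : Prop where
  rho_nonneg : 0 ≤ ρ
  M_nonneg : 0 ≤ M
  weakly_convex : ∀ (u v : Vec d) (t : ℝ), 0 ≤ t → t ≤ 1 →
    f (v + t • (u - v)) ≤ (1 - t) * f v + t * f u + t * (1 - t) * (ρ / 2) * ‖u - v‖ ^ 2
  lipschitz : ∀ u v : Vec d, f u ≤ f v + M * ‖u - v‖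

/-- The value of the Moreau envelope of `f`. -/
def env {d : ℕ} (μ : ℝ) (f : Vec d → ℝ) (w : Vec d) : ℝ :=
  f (prox μ f w) + ‖prox μ f w - w‖ ^ 2 / (2 * μ)

section Prox

variable {d : ℕ} {f : Vec d → ℝ} {ρ M μ : ℝ}

theorem norm_sub_sq_add_smul (v w p : Vec d) (t : ℝ) :
    ‖v + t • p - w‖ ^ 2 = ‖v - w‖ ^ 2 + 2 * t * inner ℝ (v - w) p + t ^ 2 * ‖p‖ ^ 2 := by
  rw [show v + t • p - w = (v - w) + t • p by abel, norm_add_sq_real, inner_smul_right, norm_smul,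
    mul_pow, Real.norm_eq_abs, sq_abs]
  ring

theorem WeaklyConvexLipschitz.continuous (hf : WeaklyConvexLipschitz f ρ M) : Continuous f := by
  refine (LipschitzWith.of_dist_le_mul (K := ⟨M, hf.M_nonneg⟩) fun u v => ?_).continuous
  rw [Real.dist_eq, abs_le, dist_eq_norm]
  have h1 := hf.lipschitz u v
  have h2 := hf.lipschitz v u
  rw [norm_sub_rev] at h2
  exact ⟨by change -(M * _) ≤ _; linarith, by change _ ≤ M * _; linarith⟩

/-- A Lipschitz function decreases at most linearly, and the quadratic outweighs this outside the
ball of radius `2 * μ * M`. -/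
theorem WeaklyConvexLipschitz.exists_isProx (hf : WeaklyConvexLipschitz f ρ M) (hμ : 0 < μ)
    (w : Vec d) : ∃ v, IsProx μ f w v := by
  have hc : Continuous fun u => f u + ‖u - w‖ ^ 2 / (2 * μ) := by
    have := hf.continuous
    fun_prop
  refine hc.exists_forall_le' w ?_
  filter_upwards [(isCompact_closedBall w (2 * μ * M)).compl_mem_cocompact] with u hu
  have hu' : 2 * μ * M ≤ ‖u - w‖ := by
    rw [Set.mem_compl_iff, Metric.mem_closedBall, not_le, dist_eq_norm] at hu
    exact hu.le
  have h1 := hf.lipschitz w u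
  rw [norm_sub_rev] at h1
  have h2 : M * ‖u - w‖ ≤ ‖u - w‖ ^ 2 / (2 * μ) := by
    rw [le_div_iff₀ (by positivity)]
    nlinarith [norm_nonneg (u - w)]
  simp only [sub_self, norm_zero, ne_eq, OfNat.ofNat_ne_zero, not_false_eq_true, zero_pow,
    zero_div, add_zero]
  linarith

/-- First-order optimality: compare `v` with `v + t • (u - v)`, use weak convexity, divide by `t`
and let `t → 0`. Uniqueness, strong convexity, the Lipschitz constant of the proximal map and the
subgradient all derive from it. -/
theorem WeaklyConvexLipschitz.le_of_isProx (hf : WeaklyConvexLipschitz f ρ M) (hμ : 0 < μ)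
    {w v : Vec d} (hv : IsProx μ f w v) (u : Vec d) :
    f v + inner ℝ (w - v) (u - v) / μ - ρ / 2 * ‖u - v‖ ^ 2 ≤ f u := by
  suffices h : f v + inner ℝ (w - v) (u - v) / μ - ρ / 2 * ‖u - v‖ ^ 2 - f u ≤ 0 by linarith
  refine nonpos_of_forall_le_mul (C := ‖u - v‖ ^ 2 / (2 * μ)) (by positivity) fun t ht ht' => ?_
  have h1 := hv (v + t • (u - v))
  have h2 := hf.weakly_convex u v t ht.le ht'
  rw [norm_sub_sq_add_smul] at h1
  have e : inner ℝ (w - v) (u - v) = -inner ℝ (v - w) (u - v) := by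
    rw [← inner_neg_left, neg_sub]
  rw [e]
  have h3 : (‖v - w‖ ^ 2 + 2 * t * inner ℝ (v - w) (u - v) + t ^ 2 * ‖u - v‖ ^ 2) / (2 * μ)
      = ‖v - w‖ ^ 2 / (2 * μ) + t * (inner ℝ (v - w) (u - v) / μ + t * (‖u - v‖ ^ 2 / (2 * μ))) := by
    field_simp
    ring
  rw [h3] at h1
  have h4 : 0 ≤ t * (t * (ρ / 2) * ‖u - v‖ ^ 2) := by
    have := hf.rho_nonneg
    positivity
  refine le_of_mul_le_mul_left ?_ ht
  rw [neg_div]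
  nlinarith

/-- Adding the optimality inequalities of two minimizers leaves `(μ⁻¹ - ρ) * ‖v - p‖ ^ 2 ≤ 0`. -/
theorem WeaklyConvexLipschitz.isProx_iff (hf : WeaklyConvexLipschitz f ρ M) (hμ : 0 < μ)
    (hρ : ρ < μ⁻¹) (w v : Vec d) : IsProx μ f w v ↔ v = prox μ f w := by
  have hp : IsProx μ f w (prox μ f w) := Classical.epsilon_spec (hf.exists_isProx hμ w)
  refine ⟨fun hv => ?_, fun h => h ▸ hp⟩
  have h1 := hf.le_of_isProx hμ hp v
  have h2 := hf.le_of_isProx hμ hv (prox μ f w)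
  set p := prox μ f w
  have e : inner ℝ (w - v) (p - v) = -inner ℝ (w - p) (v - p) + ‖v - p‖ ^ 2 := by
    rw [← real_inner_self_eq_norm_sq, ← neg_sub v p, inner_neg_right, neg_add_eq_sub,
      ← inner_sub_left, ← inner_neg_left]
    congr 1
    abel
  rw [e, norm_sub_rev p v, add_div, neg_div] at h2
  have h3 : (μ⁻¹ - ρ) * ‖v - p‖ ^ 2 ≤ 0 := by
    rw [div_eq_inv_mul (‖v - p‖ ^ 2)] at h2
    linarith
  have h4 : ‖v - p‖ ^ 2 ≤ 0 := by
    by_contra! h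
    exact absurd h3 (not_le.2 (mul_pos (sub_pos.2 hρ) h))
  have h5 : ‖v - p‖ = 0 := by nlinarith [norm_nonneg (v - p)]
  exact sub_eq_zero.1 (norm_eq_zero.1 h5)

theorem WeaklyConvexLipschitz.isProx_prox (hf : WeaklyConvexLipschitz f ρ M) (hμ : 0 < μ)
    (w : Vec d) : IsProx μ f w (prox μ f w) :=
  Classical.epsilon_spec (hf.exists_isProx hμ w)

theorem WeaklyConvexLipschitz.le_prox (hf : WeaklyConvexLipschitz f ρ M) (hμ : 0 < μ)
    (w u : Vec d) : f (prox μ f w) + inner ℝ (w - prox μ f w) (u - prox μ f w) / μ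
      - ρ / 2 * ‖u - prox μ f w‖ ^ 2 ≤ f u :=
  hf.le_of_isProx hμ (hf.isProx_prox hμ w) u

/-- Strong convexity of the proximal objective. -/
theorem WeaklyConvexLipschitz.env_add_le (hf : WeaklyConvexLipschitz f ρ M) (hμ : 0 < μ)
    (w u : Vec d) : env μ f w + (μ⁻¹ - ρ) / 2 * ‖u - prox μ f w‖ ^ 2
      ≤ f u + ‖u - w‖ ^ 2 / (2 * μ) := by
  have h := hf.le_prox hμ w u
  unfold env
  set p := prox μ f w
  have e := norm_sub_sq_add_smul p w (u - p) 1
  rw [one_smul, add_sub_cancel] at e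
  rw [e, ← neg_sub w p, inner_neg_left, norm_neg]
  have : (‖w - p‖ ^ 2 + 2 * 1 * -inner ℝ (w - p) (u - p) + 1 ^ 2 * ‖u - p‖ ^ 2) / (2 * μ)
      = ‖w - p‖ ^ 2 / (2 * μ) - inner ℝ (w - p) (u - p) / μ + μ⁻¹ / 2 * ‖u - p‖ ^ 2 := by
    field_simp
    ring
  rw [this]
  linarith

/-- Moving from the minimizer `p` towards `w` lowers the quadratic at rate `‖p - w‖ ^ 2 / μ` and
raises `f` at rate at most `M * ‖p - w‖`. -/
theorem WeaklyConvexLipschitz.norm_prox_sub_le (hf : WeaklyConvexLipschitz f ρ M) (hμ : 0 < μ)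
    (w : Vec d) : ‖prox μ f w - w‖ ≤ μ * M := by
  have hp := hf.isProx_prox hμ w
  set p := prox μ f w
  have h : ‖p - w‖ ^ 2 - μ * M * ‖p - w‖ ≤ 0 := by
    refine nonpos_of_forall_le_mul (C := ‖p - w‖ ^ 2 / 2) (by positivity) fun t ht ht' => ?_
    have h1 := hp (p + t • (w - p))
    have h2 := hf.lipschitz (p + t • (w - p)) p
    have e : inner ℝ (p - w) (w - p) = -‖p - w‖ ^ 2 := by
      rw [← neg_sub p w, inner_neg_right, real_inner_self_eq_norm_sq]
    rw [norm_sub_sq_add_smul, e, norm_sub_rev w p] at h1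
    rw [add_sub_cancel_left, norm_smul, Real.norm_eq_abs, abs_of_pos ht, norm_sub_rev w p] at h2
    have h3 : ‖p - w‖ ^ 2 / (2 * μ) ≤ M * (t * ‖p - w‖) +
        (‖p - w‖ ^ 2 + 2 * t * -‖p - w‖ ^ 2 + t ^ 2 * ‖p - w‖ ^ 2) / (2 * μ) := by linarith
    rw [← sub_le_iff_le_add, ← sub_div, div_le_iff₀ (by positivity)] at h3
    refine le_of_mul_le_mul_left ?_ ht
    nlinarith
  by_contra! hlt
  have h0 : 0 < ‖p - w‖ := lt_of_le_of_lt (mul_nonneg hμ.le hf.M_nonneg) hlt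
  nlinarith

/-- Add the optimality inequalities of the two proximal points and apply Cauchy-Schwarz. -/
theorem WeaklyConvexLipschitz.norm_prox_sub_prox_le (hf : WeaklyConvexLipschitz f ρ M) (hμ : 0 < μ)
    (hρ : ρ < μ⁻¹) (w w' : Vec d) :
    ‖prox μ f w' - prox μ f w‖ ≤ 1 / (1 - μ * ρ) * ‖w' - w‖ := by
  have h1 := hf.le_prox hμ w (prox μ f w')
  have h2 := hf.le_prox hμ w' (prox μ f w)
  set p := prox μ f w
  set p' := prox μ f w'
  have hμρ : μ * ρ < 1 := by
    have := mul_lt_mul_of_pos_left hρ hμ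
    rwa [mul_inv_cancel₀ hμ.ne'] at this
  have e : inner ℝ (w - p) (p' - p) + inner ℝ (w' - p') (p - p')
      = ‖p' - p‖ ^ 2 - inner ℝ (w' - w) (p' - p) := by
    rw [← neg_sub p' p, inner_neg_right, ← real_inner_self_eq_norm_sq, ← sub_eq_add_neg,
      ← inner_sub_left, ← inner_sub_left]
    congr 1
    abel
  rw [norm_sub_rev p p'] at h2
  have h3 : (inner ℝ (w - p) (p' - p) + inner ℝ (w' - p') (p - p')) / μ ≤ ρ * ‖p' - p‖ ^ 2 := by
    rw [add_div]
    linarith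
  rw [e, div_le_iff₀ hμ] at h3
  have h4 := real_inner_le_norm (w' - w) (p' - p)
  rw [one_div_mul_eq_div, le_div_iff₀ (by linarith)]
  by_contra! hlt
  have h0 : 0 < ‖p' - p‖ := by
    by_contra! h
    have : ‖p' - p‖ = 0 := le_antisymm h (norm_nonneg _)
    rw [this, zero_mul] at hlt
    exact absurd hlt (not_lt.2 (norm_nonneg _))
  nlinarith

/-- The optimality inequality is a subgradient inequality up to `ρ / 2 * ‖v - p‖ ^ 2`, which is
`o(‖v - p‖)`. -/
theorem WeaklyConvexLipschitz.mem_subdiff (hf : WeaklyConvexLipschitz f ρ M) (hμ : 0 < μ)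
    (w : Vec d) : μ⁻¹ • (w - prox μ f w) ∈ subdiff f (prox μ f w) := by
  intro δ hδ
  set p := prox μ f w with hp
  filter_upwards [Metric.ball_mem_nhds p (show 0 < δ / (ρ / 2 + 1) by
    have := hf.rho_nonneg
    positivity)] with v hv
  have h1 := hf.le_prox hμ w v
  rw [← hp] at h1
  rw [Metric.mem_ball, dist_eq_norm, lt_div_iff₀ (by linarith [hf.rho_nonneg])] at hv
  rw [real_inner_smul_left, inv_mul_eq_div]
  nlinarith [norm_nonneg (v - p), hf.rho_nonneg]

/-- The proximal point of `w` is a competitor in the problem at `w'`. -/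
theorem WeaklyConvexLipschitz.env_le_add (hf : WeaklyConvexLipschitz f ρ M) (hμ : 0 < μ)
    (w w' : Vec d) :
    env μ f w' ≤ env μ f w + inner ℝ (w - prox μ f w) (w' - w) / μ + ‖w' - w‖ ^ 2 / (2 * μ) := by
  have h := hf.isProx_prox hμ w' (prox μ f w)
  unfold env
  set p := prox μ f w
  refine h.trans (le_of_eq ?_)
  rw [← sub_sub_sub_cancel_right p w' w, norm_sub_sq_real (p - w), ← neg_sub p w, inner_neg_left]
  field_simp
  ring

/-- The optimality inequality at `w` is evaluated at the proximal point of `w'`. Completing a square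
eliminates `p' - p` and produces the constant `ρ / (1 - μ * ρ)`. -/
theorem WeaklyConvexLipschitz.le_env (hf : WeaklyConvexLipschitz f ρ M) (hμ : 0 < μ)
    (hρ : ρ < μ⁻¹) (w w' : Vec d) :
    env μ f w + inner ℝ (w - prox μ f w) (w' - w) / μ - ρ / (1 - μ * ρ) / 2 * ‖w' - w‖ ^ 2
      ≤ env μ f w' := by
  have h := hf.le_prox hμ w (prox μ f w')
  have hμρ : μ * ρ < 1 := by
    have := mul_lt_mul_of_pos_left hρ hμ
    rwa [mul_inv_cancel₀ hμ.ne'] at this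
  have hpos : 0 < 1 - μ * ρ := by linarith
  unfold env
  set p := prox μ f w
  set p' := prox μ f w'
  have e1 : ‖p' - w'‖ ^ 2 = ‖p - w‖ ^ 2 - 2 * inner ℝ (w - p) (p' - p)
      + 2 * inner ℝ (w - p) (w' - w) + ‖p' - p‖ ^ 2 - 2 * inner ℝ (p' - p) (w' - w)
      + ‖w' - w‖ ^ 2 := by
    rw [show p' - w' = -(w - p) + ((p' - p) - (w' - w)) by abel, norm_add_sq_real, norm_neg,
      norm_sub_sq_real (p' - p), inner_neg_left, inner_sub_right, norm_sub_rev w p]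
    ring
  have e2 := sq_nonneg ‖(1 - μ * ρ) • (p' - p) - (w' - w)‖
  rw [norm_sub_sq_real, norm_smul, real_inner_smul_left, mul_pow, Real.norm_eq_abs, sq_abs] at e2
  have e3 : 0 ≤ ((1 - μ * ρ) ^ 2 * ‖p' - p‖ ^ 2 - 2 * ((1 - μ * ρ) * inner ℝ (p' - p) (w' - w))
      + ‖w' - w‖ ^ 2) / (2 * μ * (1 - μ * ρ)) := by positivity
  have e4 : ((1 - μ * ρ) ^ 2 * ‖p' - p‖ ^ 2 - 2 * ((1 - μ * ρ) * inner ℝ (p' - p) (w' - w))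
      + ‖w' - w‖ ^ 2) / (2 * μ * (1 - μ * ρ))
      = (‖p' - p‖ ^ 2 - 2 * inner ℝ (p' - p) (w' - w) + ‖w' - w‖ ^ 2) / (2 * μ)
        - ρ / 2 * ‖p' - p‖ ^ 2 + ρ / (1 - μ * ρ) / 2 * ‖w' - w‖ ^ 2 := by
    field_simp
    ring
  have e5 : (‖p - w‖ ^ 2 - 2 * inner ℝ (w - p) (p' - p)
      + 2 * inner ℝ (w - p) (w' - w) + ‖p' - p‖ ^ 2 - 2 * inner ℝ (p' - p) (w' - w)
      + ‖w' - w‖ ^ 2) / (2 * μ) = ‖p - w‖ ^ 2 / (2 * μ) - inner ℝ (w - p) (p' - p) / μ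
      + inner ℝ (w - p) (w' - w) / μ
      + (‖p' - p‖ ^ 2 - 2 * inner ℝ (p' - p) (w' - w) + ‖w' - w‖ ^ 2) / (2 * μ) := by
    field_simp
    ring
  rw [e1, e5]
  linarith

end Prox

/-! ### The functions `f^l` and `g^l` -/

section Losses

variable {d Np Nm : ℕ} {s : Fin Np → Fin Nm → Vec d → ℝ} {m n l : ℕ} {L B : ℝ}

theorem gFun_eq_sum_hinge (s : Fin Np → Fin Nm → Vec d → ℝ) (l : ℕ) (v : Vec d) (lam : Vec Np) :
    gFun s l v lam = ∑ i, hinge l (fun j => s i j v) (lam i) := by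
  simp only [gFun, hinge, Finset.sum_add_distrib, Finset.mul_sum]

theorem fTop_le_gFun (hl : l ≤ Nm) (v : Vec d) (lam : Vec Np) : fTop s l v ≤ gFun s l v lam := by
  rw [gFun_eq_sum_hinge]
  exact Finset.sum_le_sum fun i _ => topSum_le_hinge hl _ _

theorem mem_lamArgmin_of_eq (hl : l ≤ Nm) {v : Vec d} {lam : Vec Np}
    (h : gFun s l v lam = fTop s l v) : lam ∈ lamArgmin s l v :=
  fun lam' => h.le.trans (fTop_le_gFun hl v lam')

theorem norm_le_sum_abs {N : ℕ} (x : Vec N) : ‖x‖ ≤ ∑ i, |x i| := by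
  rw [EuclideanSpace.norm_eq]
  refine (Real.sqrt_le_left (Finset.sum_nonneg fun i _ => abs_nonneg _)).2 ?_
  simpa only [Real.norm_eq_abs] using
    Finset.sum_sq_le_sq_sum_of_nonneg (s := Finset.univ) (f := fun i => |x i|)
      fun i _ => abs_nonneg (x i)

theorem SmoothLosses.abs_sub_le (hs : SmoothLosses s m n L B) (i : Fin Np) (j : Fin Nm)
    (u v : Vec d) : |s i j u - s i j v| ≤ B * ‖u - v‖ :=
  abs_sub_le_of_gradient_bounded (hs.differentiable i j) (hs.grad_bounded i j) u v

/-- The problem in `λ` separates over the rows, so the one-dimensional sharpness is applied in each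
row; the sum of the absolute values dominates the Euclidean norm. -/
theorem SmoothLosses.exists_lam_near (hs : SmoothLosses s m n L B) (hl : l ≤ Nm)
    (v v' : Vec d) (lam : Vec Np) : ∃ lam' : Vec Np, gFun s l v' lam' = fTop s l v' ∧
      dist lam lam' ≤ gFun s l v lam - fTop s l v + Np * (B * ‖v - v'‖) := by
  choose x hx hx' using fun i => exists_hinge_eq_near hl
    (mul_nonneg hs.B_nonneg (norm_nonneg (v - v'))) (fun j => hs.abs_sub_le i j v v') (lam i)
  refine ⟨WithLp.toLp 2 x, ?_, ?_⟩
  · rw [gFun_eq_sum_hinge]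
    exact Finset.sum_congr rfl fun i _ => hx i
  · rw [dist_eq_norm]
    refine (norm_le_sum_abs _).trans ((Finset.sum_le_sum fun i _ => hx' i).trans (le_of_eq ?_))
    rw [Finset.sum_add_distrib, Finset.sum_sub_distrib, gFun_eq_sum_hinge, fTop, Finset.sum_const,
      Finset.card_univ, Fintype.card_fin, nsmul_eq_mul]

theorem SmoothLosses.lamArgmin_nonempty (hs : SmoothLosses s m n L B) (hl : l ≤ Nm) (v : Vec d) :
    (lamArgmin s l v).Nonempty :=
  (hs.exists_lam_near hl v v 0).imp fun _ h => mem_lamArgmin_of_eq hl h.1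

theorem SmoothLosses.gFun_eq_of_mem (hs : SmoothLosses s m n L B) (hl : l ≤ Nm) {v : Vec d}
    {lam : Vec Np} (h : lam ∈ lamArgmin s l v) : gFun s l v lam = fTop s l v := by
  obtain ⟨lam', h', -⟩ := hs.exists_lam_near hl v v 0
  exact le_antisymm (h' ▸ h lam') (fTop_le_gFun hl v lam)

/-- Used with `v` an inner output and `v'` the next exact proximal point, it bounds the dual
distance from which the next inner call starts. -/
theorem SmoothLosses.infDist_lamArgmin_le (hs : SmoothLosses s m n L B) (hl : l ≤ Nm)
    (v v' : Vec d) (lam : Vec Np) : Metric.infDist lam (lamArgmin s l v') ≤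
      gFun s l v lam - fTop s l v + Np * (B * ‖v - v'‖) := by
  obtain ⟨lam', h1, h2⟩ := hs.exists_lam_near hl v v' lam
  exact (Metric.infDist_le_dist_of_mem (mem_lamArgmin_of_eq hl h1)).trans h2

theorem isClosed_lamArgmin (v : Vec d) : IsClosed (lamArgmin s l v) := by
  have : lamArgmin s l v = ⋂ lam', {lam | gFun s l v lam ≤ gFun s l v lam'} := by
    ext
    simp [lamArgmin]
  rw [this]
  refine isClosed_iInter fun lam' => isClosed_le ?_ continuous_const
  unfold gFun
  fun_prop

theorem SmoothLosses.exists_nearest_lam (hs : SmoothLosses s m n L B) (hl : l ≤ Nm) (v : Vec d)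
    (lam : Vec Np) : ∃ lam', gFun s l v lam' = fTop s l v ∧
      dist lam lam' = Metric.infDist lam (lamArgmin s l v) := by
  obtain ⟨lam', h1, h2⟩ := (isClosed_lamArgmin v).exists_infDist_eq_dist
    (hs.lamArgmin_nonempty hl v) lam
  exact ⟨lam', hs.gFun_eq_of_mem hl h1, h2.symm⟩

theorem SmoothLosses.weaklyConvexLipschitz (hs : SmoothLosses s m n L B) (hl : l ≤ Nm) :
    WeaklyConvexLipschitz (fTop s l) (Np * Nm * L) (Np * l * B) where
  rho_nonneg := by have := hs.L_nonneg; positivity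
  M_nonneg := by have := hs.B_nonneg; positivity
  weakly_convex u v t ht ht' := by
    have h : ∀ i, topSum l (fun j => s i j (v + t • (u - v)))
        ≤ (1 - t) * topSum l (fun j => s i j v) + t * topSum l (fun j => s i j u)
          + l * (t * (1 - t) * (L / 2) * ‖u - v‖ ^ 2) := fun i =>
      topSum_convex_combination_le hl ht ht' fun j =>
        weakly_convex_of_lipschitz_gradient (hs.differentiable i j) (hs.grad_lipschitz i j) u v
          ht ht'
    have h2 := Finset.sum_le_sum fun i (_ : i ∈ Finset.univ) => h i
    rw [Finset.sum_add_distrib, Finset.sum_add_distrib, Finset.sum_const, Finset.card_univ,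
      Fintype.card_fin, nsmul_eq_mul, ← Finset.mul_sum, ← Finset.mul_sum] at h2
    refine h2.trans ?_
    unfold fTop
    -- Each row yields the modulus `l * L`; `l ≤ Nm` gives one constant for both values of `l`.
    have h3 : (l : ℝ) * (t * (1 - t) * (L / 2) * ‖u - v‖ ^ 2)
        ≤ Nm * (t * (1 - t) * (L / 2) * ‖u - v‖ ^ 2) := by
      have := hs.L_nonneg
      have := sub_nonneg.2 ht'
      gcongr
    have h4 := mul_le_mul_of_nonneg_left h3 (Nat.cast_nonneg (α := ℝ) Np)
    linarith
  lipschitz u v := by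
    have h : ∀ i, topSum l (fun j => s i j u) ≤ topSum l (fun j => s i j v)
        + l * (B * ‖u - v‖) := fun i =>
      topSum_le_add hl fun j => by linarith [(abs_le.1 (hs.abs_sub_le i j u v)).2]
    have h2 := Finset.sum_le_sum fun i (_ : i ∈ Finset.univ) => h i
    rw [Finset.sum_add_distrib, Finset.sum_const, Finset.card_univ,
      Fintype.card_fin, nsmul_eq_mul] at h2
    unfold fTop
    linarith

/-- The partial subgradient of `g^l` in `v`. -/
def subgradV (s : Fin Np → Fin Nm → Vec d → ℝ) (v : Vec d) (lam : Vec Np) : Vec d :=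
  ∑ i, ∑ j, if lam i < s i j v then gradient (s i j) v else 0

/-- The partial subgradient of `g^l` in `λ`. -/
def subgradLam (s : Fin Np → Fin Nm → Vec d → ℝ) (l : ℕ) (v : Vec d) (lam : Vec Np)
    (i : Fin Np) : ℝ :=
  l - ∑ j, if lam i < s i j v then (1 : ℝ) else 0

/-- Term by term: an active positive part inherits the quadratic lower bound of `s i j`, an inactive
one has subgradient zero. -/
theorem SmoothLosses.gFun_add_le (hs : SmoothLosses s m n L B) (l : ℕ) (v v' : Vec d)
    (lam lam' : Vec Np) :
    gFun s l v lam + inner ℝ (subgradV s v lam) (v' - v)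
      + ∑ i, subgradLam s l v lam i * (lam' i - lam i) - Np * Nm * L / 2 * ‖v' - v‖ ^ 2
      ≤ gFun s l v' lam' := by
  have key : ∀ i j, max (s i j v - lam i) 0
      + inner ℝ (if lam i < s i j v then gradient (s i j) v else 0) (v' - v)
      - (if lam i < s i j v then (1 : ℝ) else 0) * (lam' i - lam i) - L / 2 * ‖v' - v‖ ^ 2
      ≤ max (s i j v' - lam' i) 0 := by
    intro i j
    have hL := hs.L_nonneg
    have hq : 0 ≤ L / 2 * ‖v' - v‖ ^ 2 := by positivity
    split_ifs with h
    · rw [max_eq_left (by linarith)]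
      have := quadratic_lower_bound (hs.differentiable i j) (hs.grad_lipschitz i j) v' v
      exact le_trans (by linarith) (le_max_left _ _)
    · rw [max_eq_right (by linarith), inner_zero_left]
      exact le_trans (by linarith) (le_max_right _ _)
  have h2 := Finset.sum_le_sum fun i (_ : i ∈ Finset.univ) =>
    Finset.sum_le_sum fun j (_ : j ∈ Finset.univ) => key i j
  simp only [Finset.sum_add_distrib, Finset.sum_sub_distrib, Finset.sum_const, Finset.card_univ,
    Fintype.card_fin, nsmul_eq_mul, ← sum_inner, ← Finset.sum_mul] at h2
  simp only [gFun, subgradV, subgradLam, sub_mul, Finset.sum_sub_distrib,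
    ← Finset.mul_sum, mul_sub] at h2 ⊢
  linarith

end Losses

/-! ### Averages over the draws -/

/-- Double counting: each index lies in `(N - 1).choose (k - 1)` of the sets. -/
theorem sum_powersetCard_sum {N k : ℕ} (hk : 1 ≤ k) (hkN : k ≤ N) (f : Fin N → ℝ) :
    ∑ A ∈ (Finset.univ : Finset (Fin N)).powersetCard k, ∑ i ∈ A, f i
      = (N.choose k : ℝ) * (k / N) * ∑ i, f i := by
  have h1 : ∑ A ∈ (Finset.univ : Finset (Fin N)).powersetCard k, ∑ i ∈ A, f i
      = ∑ i, ∑ A ∈ (Finset.univ : Finset (Fin N)).powersetCard k with {i} ⊆ A, f i := by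
    rw [Finset.sum_comm']
    simp
  have h2 : (N : ℝ) * ((N - 1).choose (k - 1) : ℕ) = (N.choose k : ℕ) * k := by
    obtain ⟨k, rfl⟩ : ∃ k', k = k' + 1 := ⟨k - 1, by omega⟩
    obtain ⟨N, rfl⟩ : ∃ N', N = N' + 1 := ⟨N - 1, by omega⟩
    exact_mod_cast Nat.add_one_mul_choose_eq N k
  have hN : (N : ℝ) ≠ 0 := by
    have : N ≠ 0 := by omega
    exact_mod_cast this
  rw [h1, Finset.mul_sum]
  refine Finset.sum_congr rfl fun i _ => ?_
  rw [Finset.sum_const, Finset.card_filter_powersetCard_subset _ _ _ (Finset.subset_univ _)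
    (by simpa using hk), nsmul_eq_mul, Finset.card_singleton, Finset.card_univ, Fintype.card_fin]
  rw [← mul_div_assoc, ← h2]
  field_simp

/-- The average of `h` over all draws with `I` rows and `J` columns. -/
def sampleAvg {Np Nm : ℕ} (I J : ℕ) (h : Sample Np Nm → ℝ) : ℝ :=
  (Np.choose I * Nm.choose J : ℝ)⁻¹ *
    ∑ A ∈ (Finset.univ : Finset (Fin Np)).powersetCard I,
      ∑ C ∈ (Finset.univ : Finset (Fin Nm)).powersetCard J, h ⟨A, C⟩

section Average

variable {Np Nm I J : ℕ}

theorem sampleAvg_mono {h h' : Sample Np Nm → ℝ}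
    (H : ∀ z : Sample Np Nm, z.rows.card = I → z.cols.card = J → h z ≤ h' z) :
    sampleAvg I J h ≤ sampleAvg I J h' := by
  unfold sampleAvg
  refine mul_le_mul_of_nonneg_left (Finset.sum_le_sum fun A hA => Finset.sum_le_sum fun C hC => ?_)
    (by positivity)
  exact H _ (Finset.mem_powersetCard.1 hA).2 (Finset.mem_powersetCard.1 hC).2

theorem sampleAvg_const_sub (hI : I ≤ Np) (hJ : J ≤ Nm) (c : ℝ) (h : Sample Np Nm → ℝ) :
    sampleAvg I J (fun z => c - h z) = c - sampleAvg I J h := by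
  have h1 : (Np.choose I : ℝ) ≠ 0 := by exact_mod_cast (Nat.choose_pos hI).ne'
  have h2 : (Nm.choose J : ℝ) ≠ 0 := by exact_mod_cast (Nat.choose_pos hJ).ne'
  simp only [sampleAvg, Finset.sum_sub_distrib, Finset.sum_const, Finset.card_powersetCard,
    Finset.card_univ, Fintype.card_fin, nsmul_eq_mul]
  field_simp

/-- The rescaled block sums are unbiased. -/
theorem sampleAvg_block (hI : 1 ≤ I) (hI' : I ≤ Np) (hJ : 1 ≤ J) (hJ' : J ≤ Nm)
    (f : Fin Np → Fin Nm → ℝ) (e : Fin Np → ℝ) :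
    sampleAvg I J (fun z : Sample Np Nm => (Np * Nm : ℝ) / (I * J) * (∑ i ∈ z.rows, ∑ j ∈ z.cols,
      f i j) + Np / I * ∑ i ∈ z.rows, e i) = ∑ i, ∑ j, f i j + ∑ i, e i := by
  have h1 : (Np.choose I : ℝ) ≠ 0 := by exact_mod_cast (Nat.choose_pos hI').ne'
  have h2 : (Nm.choose J : ℝ) ≠ 0 := by exact_mod_cast (Nat.choose_pos hJ').ne'
  have h3 : (I : ℝ) ≠ 0 := by exact_mod_cast (by omega : I ≠ 0)
  have h4 : (J : ℝ) ≠ 0 := by exact_mod_cast (by omega : J ≠ 0)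
  have h5 : (Np : ℝ) ≠ 0 := by exact_mod_cast (by omega : Np ≠ 0)
  have h6 : (Nm : ℝ) ≠ 0 := by exact_mod_cast (by omega : Nm ≠ 0)
  have e1 : ∀ A : Finset (Fin Np), ∑ C ∈ (Finset.univ : Finset (Fin Nm)).powersetCard J,
      ∑ i ∈ A, ∑ j ∈ C, f i j = (Nm.choose J : ℝ) * (J / Nm) * ∑ i ∈ A, ∑ j, f i j := by
    intro A
    rw [Finset.sum_comm, Finset.mul_sum]
    exact Finset.sum_congr rfl fun i _ => sum_powersetCard_sum hJ hJ' _
  simp only [sampleAvg, Finset.sum_add_distrib, ← Finset.mul_sum, e1, Finset.sum_const,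
    Finset.card_powersetCard, Finset.card_univ, Fintype.card_fin, nsmul_eq_mul,
    sum_powersetCard_sum hI hI']
  field_simp

end Average

/-! ### One step of SBCD -/

section Step

variable {d Np Nm : ℕ} {s : Fin Np → Fin Nm → Vec d → ℝ} {m n l I J : ℕ} {L B μ η θ : ℝ}

theorem proxStep_zero (hμ : 0 < μ) (w v G : Vec d) : proxStep μ 0 w v G = v := by
  simp [proxStep, smul_smul, inv_mul_cancel₀ hμ.ne']

/-- `proxStep_spec` is evaluated at `vs`, and Young's inequality pays for testing `G` at `v` instead
of the new point. If `η = 0`, the quotients by `2 * η` are zero by convention and the three points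
coincide. -/
theorem proxStep_descent (hμ : 0 < μ) {w v vs G : Vec d} {Γ : ℝ}
    (hη : 0 < η ∨ η = 0 ∧ v = w ∧ vs = w) (hG : ‖G‖ ≤ Γ) :
    inner ℝ G (v - vs) + ‖proxStep μ η w v G - w‖ ^ 2 / (2 * μ)
      + ‖proxStep μ η w v G - vs‖ ^ 2 / (2 * μ)
      + (‖proxStep μ η w v G - vs‖ ^ 2 / (2 * η) - ‖v - vs‖ ^ 2 / (2 * η))
      ≤ ‖vs - w‖ ^ 2 / (2 * μ) + η / 2 * Γ ^ 2 := by
  rcases hη with hη | ⟨rfl, rfl, rfl⟩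
  · have h := proxStep_spec hμ hη w v G vs
    set p := proxStep μ η w v G
    have h1 : inner ℝ G (v - p) ≤ η / 2 * Γ ^ 2 + ‖p - v‖ ^ 2 / (2 * η) := by
      refine (real_inner_le_norm _ _).trans ?_
      rw [norm_sub_rev v p]
      have h2 : 0 ≤ (η * ‖G‖ - ‖p - v‖) ^ 2 / (2 * η) := by positivity
      have h3 : (η * ‖G‖ - ‖p - v‖) ^ 2 / (2 * η)
          = η / 2 * ‖G‖ ^ 2 + ‖p - v‖ ^ 2 / (2 * η) - ‖G‖ * ‖p - v‖ := by
        field_simp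
        ring
      have h4 : ‖G‖ ^ 2 ≤ Γ ^ 2 := by gcongr
      have h5 := mul_le_mul_of_nonneg_left h4 (by positivity : 0 ≤ η / 2)
      linarith
    rw [inner_sub_right] at h1 ⊢
    rw [norm_sub_rev vs p, norm_sub_rev vs v, add_mul, one_div_mul_eq_div, one_div_mul_eq_div] at h
    linarith
  · simp [proxStep_zero hμ]

theorem norm_gradV_le (hs : SmoothLosses s m n L B) (hI : 1 ≤ I) (hJ : 1 ≤ J) {z : Sample Np Nm}
    (hz : z.rows.card = I) (hz' : z.cols.card = J) (v : Vec d) (lam : Vec Np) :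
    ‖gradV s I J z v lam‖ ≤ Np * Nm * B := by
  have h1 : ‖∑ i ∈ z.rows, ∑ j ∈ z.cols, if lam i < s i j v then gradient (s i j) v else 0‖
      ≤ I * (J * B) := by
    refine (norm_sum_le_of_le z.rows (f := fun i => ∑ j ∈ z.cols,
      if lam i < s i j v then gradient (s i j) v else 0) (n := fun _ => J * B)
      fun i _ => ?_).trans (by simp [hz])
    refine (norm_sum_le_of_le z.cols (n := fun _ => B) fun j _ => ?_).trans (by simp [hz'])
    split_ifs
    · exact hs.grad_bounded i j v
    · simpa using hs.B_nonneg
  have h3 : (0 : ℝ) < I := by exact_mod_cast hI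
  have h4 : (0 : ℝ) < J := by exact_mod_cast hJ
  rw [gradV, norm_smul, Real.norm_eq_abs, abs_of_nonneg (by positivity)]
  refine (mul_le_mul_of_nonneg_left h1 (by positivity)).trans (le_of_eq ?_)
  field_simp

theorem sq_gradLam_le (hl : l ≤ Nm) (hJ : 1 ≤ J) {z : Sample Np Nm}
    (hz' : z.cols.card = J) (v : Vec d) (lam : Vec Np) (i : Fin Np) :
    gradLam s J l z v lam i ^ 2 ≤ (Nm : ℝ) ^ 2 := by
  have h4 : (0 : ℝ) < J := by exact_mod_cast hJ
  have h0 : 0 ≤ ∑ j ∈ z.cols, if lam i < s i j v then (1 : ℝ) else 0 :=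
    Finset.sum_nonneg fun j _ => by split_ifs <;> norm_num
  have h1 : ∑ j ∈ z.cols, (if lam i < s i j v then (1 : ℝ) else 0) ≤ J := by
    refine (Finset.sum_le_card_nsmul _ _ 1 fun j _ => by split_ifs <;> norm_num).trans ?_
    simp [hz']
  have h2 : (Nm : ℝ) / J * ∑ j ∈ z.cols, (if lam i < s i j v then (1 : ℝ) else 0) ≤ Nm := by
    refine (mul_le_mul_of_nonneg_left h1 (by positivity)).trans (le_of_eq ?_)
    field_simp
  have h3 : 0 ≤ (Nm : ℝ) / J * ∑ j ∈ z.cols, (if lam i < s i j v then (1 : ℝ) else 0) := by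
    positivity
  have h5 : (l : ℝ) ≤ Nm := by exact_mod_cast hl
  have h6 : (0 : ℝ) ≤ l := by positivity
  rw [sq_le_sq, abs_of_nonneg (by positivity : (0 : ℝ) ≤ Nm), abs_le, gradLam]
  constructor <;> linarith

theorem block_update_sq (θ : ℝ) (z : Finset (Fin Np)) (lam lams : Vec Np) (G : Fin Np → ℝ) :
    ‖(WithLp.toLp 2 fun i => if i ∈ z then lam i - θ * G i else lam i : Vec Np) - lams‖ ^ 2
      = ‖lam - lams‖ ^ 2 - 2 * θ * ∑ i ∈ z, G i * (lam i - lams i) + θ ^ 2 * ∑ i ∈ z, G i ^ 2 := by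
  have h : ∀ F : Fin Np → ℝ, ∑ i ∈ z, F i = ∑ i, if i ∈ z then F i else 0 := fun F => by
    rw [Finset.sum_ite_mem, Finset.univ_inter]
  rw [h, h, EuclideanSpace.norm_sq_eq, EuclideanSpace.norm_sq_eq, Finset.mul_sum, Finset.mul_sum,
    ← Finset.sum_sub_distrib, ← Finset.sum_add_distrib]
  refine Finset.sum_congr rfl fun i _ => ?_
  simp only [PiLp.sub_apply, Real.norm_eq_abs, sq_abs]
  split_ifs <;> ring

/-- The weight `Np / (2 * θ * I)` compensates for updating only `I` of the `Np` coordinates. If `θ =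
0`, every term vanishes. -/
theorem block_update_descent {c : ℝ} (hI : 1 ≤ I) {z : Finset (Fin Np)} (hz : z.card = I)
    {lam lams : Vec Np} {G : Fin Np → ℝ} (hG : ∀ i, G i ^ 2 ≤ c)
    (hθ : 0 < θ ∨ θ = 0 ∧ lam = lams) :
    Np / I * ∑ i ∈ z, G i * (lam i - lams i)
      + (Np / (2 * θ * I) * ‖(WithLp.toLp 2 fun i => if i ∈ z then lam i - θ * G i else lam i :
          Vec Np) - lams‖ ^ 2 - Np / (2 * θ * I) * ‖lam - lams‖ ^ 2) ≤ θ * Np * c / 2 := by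
  have h3 : (0 : ℝ) < I := by exact_mod_cast hI
  rcases hθ with hθ | ⟨rfl, rfl⟩
  · have h1 : ∑ i ∈ z, G i ^ 2 ≤ I * c := by
      refine (Finset.sum_le_card_nsmul _ _ c fun i _ => hG i).trans ?_
      simp [hz]
    have h2 : Np * θ / (2 * I) * ∑ i ∈ z, G i ^ 2 ≤ Np * θ / (2 * I) * (I * c) :=
      mul_le_mul_of_nonneg_left h1 (by positivity)
    have h4 : Np * θ / (2 * I) * (I * c) = θ * Np * c / 2 := by field_simp
    rw [block_update_sq]
    rw [h4] at h2
    refine le_trans (le_of_eq ?_) h2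
    field_simp
    ring
  · simp

/-- The suboptimality of `x` for the inner problem `min g^l(v, λ) + ‖v - w‖² / (2μ)`. -/
def gap (s : Fin Np → Fin Nm → Vec d → ℝ) (l : ℕ) (μ : ℝ) (w : Vec d) (x : Vec d × Vec Np) : ℝ :=
  gFun s l x.1 x.2 + ‖x.1 - w‖ ^ 2 / (2 * μ) - env μ (fTop s l) w

/-- The Lyapunov function of SBCD, for the reference point `(vs, lams)`. -/
def potential (I : ℕ) (μ ρ η θ : ℝ) (w vs : Vec d) (lams : Vec Np) (x : Vec d × Vec Np) : ℝ :=
  ‖x.1 - w‖ ^ 2 / (2 * μ) + ρ / 2 * ‖x.1 - vs‖ ^ 2 + ‖x.1 - vs‖ ^ 2 / (2 * η)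
    + Np / (2 * θ * I) * ‖x.2 - lams‖ ^ 2

/-- Averaging over the draw turns the block sums into the full subgradient, tested against the exact
solution. The curvature loss `ρ / 2 * ‖v - vs‖ ^ 2` of the subgradient inequality is paid by the
matching term of the potential. After the step that term is restored by the strong convexity of the
proximal update, since `ρ < μ⁻¹`. -/
theorem sbcdStep_descent (hs : SmoothLosses s m n L B) (hl : l ≤ Nm) (hI : 1 ≤ I) (hI' : I ≤ Np)
    (hJ : 1 ≤ J) (hJ' : J ≤ Nm) (hμ : 0 < μ) (hρ : Np * Nm * L < μ⁻¹) {w : Vec d} {lams : Vec Np}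
    (hlams : gFun s l (prox μ (fTop s l) w) lams = fTop s l (prox μ (fTop s l) w))
    {x : Vec d × Vec Np} (hη : 0 < η ∨ η = 0 ∧ x.1 = w ∧ prox μ (fTop s l) w = w)
    (hθ : 0 < θ ∨ θ = 0 ∧ x.2 = lams) :
    gap s l μ w x + sampleAvg I J (fun z : Sample Np Nm =>
        potential I μ (Np * Nm * L) η θ w (prox μ (fTop s l) w) lams (sbcdStep s I J l μ η θ w z x))
      ≤ potential I μ (Np * Nm * L) η θ w (prox μ (fTop s l) w) lams x
        + (η / 2 * (Np * Nm * B) ^ 2 + θ * Np * Nm ^ 2 / 2) := by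
  set vs := prox μ (fTop s l) w with hvs
  obtain ⟨v, lam⟩ := x
  dsimp only at hη hθ
  have h3 : (I : ℝ) ≠ 0 := by exact_mod_cast (by omega : I ≠ 0)
  have h4 : (J : ℝ) ≠ 0 := by exact_mod_cast (by omega : J ≠ 0)
  set F : Fin Np → Fin Nm → ℝ := fun i j =>
    inner ℝ (if lam i < s i j v then gradient (s i j) v else 0) (v - vs)
      - (if lam i < s i j v then (1 : ℝ) else 0) * (lam i - lams i) with hF
  set e : Fin Np → ℝ := fun i => l * (lam i - lams i) with he
  set c : ℝ := ‖vs - w‖ ^ 2 / (2 * μ) + ‖v - vs‖ ^ 2 / (2 * η)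
    + Np / (2 * θ * I) * ‖lam - lams‖ ^ 2 + (η / 2 * (Np * Nm * B) ^ 2 + θ * Np * Nm ^ 2 / 2)
    with hc
  have key : ∀ z : Sample Np Nm, z.rows.card = I → z.cols.card = J →
      potential I μ (Np * Nm * L) η θ w vs lams (sbcdStep s I J l μ η θ w z (v, lam))
        ≤ c - ((Np * Nm : ℝ) / (I * J) * (∑ i ∈ z.rows, ∑ j ∈ z.cols, F i j)
          + Np / I * ∑ i ∈ z.rows, e i) := by
    intro z hz hz'
    have h1 := proxStep_descent hμ hη (norm_gradV_le hs hI hJ hz hz' v lam)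
    have h2 := block_update_descent hI hz (fun i => sq_gradLam_le (s := s) hl hJ hz' v lam i) hθ
    have e1 : inner ℝ (gradV s I J z v lam) (v - vs)
        + Np / I * ∑ i ∈ z.rows, gradLam s J l z v lam i * (lam i - lams i)
        = (Np * Nm : ℝ) / (I * J) * (∑ i ∈ z.rows, ∑ j ∈ z.cols, F i j)
          + Np / I * ∑ i ∈ z.rows, e i := by
      simp only [gradV, gradLam, hF, he, real_inner_smul_left, sum_inner, sub_mul,
        Finset.sum_sub_distrib, Finset.sum_mul, Finset.mul_sum, mul_sub, mul_assoc]
      have : ∀ i j, (Np : ℝ) / I * ((Nm : ℝ) / J * ((if lam i < s i j v then (1 : ℝ) else 0)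
          * lam i)) = (Np * Nm : ℝ) / (I * J) * ((if lam i < s i j v then (1 : ℝ) else 0)
          * lam i) := fun i j => by field_simp
      have h' : ∀ i j, (Np : ℝ) / I * ((Nm : ℝ) / J * ((if lam i < s i j v then (1 : ℝ) else 0)
          * lams i)) = (Np * Nm : ℝ) / (I * J) * ((if lam i < s i j v then (1 : ℝ) else 0)
          * lams i) := fun i j => by field_simp
      simp only [this, h']
      ring
    have h5 : Np * Nm * L / 2 * ‖proxStep μ η w v (gradV s I J z v lam) - vs‖ ^ 2
        ≤ ‖proxStep μ η w v (gradV s I J z v lam) - vs‖ ^ 2 / (2 * μ) := by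
      rw [show ‖proxStep μ η w v (gradV s I J z v lam) - vs‖ ^ 2 / (2 * μ)
        = μ⁻¹ / 2 * ‖proxStep μ η w v (gradV s I J z v lam) - vs‖ ^ 2 by field_simp]
      gcongr
    rw [← e1]
    simp only [potential, sbcdStep, hc]
    linarith
  have h5 := sampleAvg_mono key
  rw [sampleAvg_const_sub hI' hJ', sampleAvg_block hI hI' hJ hJ'] at h5
  have h6 := hs.gFun_add_le l v vs lam lams
  have e2 : inner ℝ (subgradV s v lam) (vs - v) + ∑ i, subgradLam s l v lam i * (lams i - lam i)
      = -(∑ i, ∑ j, F i j + ∑ i, e i) := by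
    rw [← neg_sub v vs, inner_neg_right]
    simp only [subgradV, subgradLam, hF, he, sum_inner, sub_mul, Finset.sum_sub_distrib,
      Finset.sum_mul, mul_sub]
    ring
  rw [norm_sub_rev vs v, hlams] at h6
  have hpot : potential I μ (Np * Nm * L) η θ w vs lams (v, lam) = ‖v - w‖ ^ 2 / (2 * μ)
    + Np * Nm * L / 2 * ‖v - vs‖ ^ 2 + ‖v - vs‖ ^ 2 / (2 * η)
    + Np / (2 * θ * I) * ‖lam - lams‖ ^ 2 := rfl
  have hgap : gap s l μ w (v, lam) = gFun s l v lam + ‖v - w‖ ^ 2 / (2 * μ)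
    - (fTop s l vs + ‖vs - w‖ ^ 2 / (2 * μ)) := rfl
  rw [hpot, hgap]
  rw [hc] at h5
  linarith

theorem sbcdIter_fst_of_eta_zero (hμ : 0 < μ) (w : Vec d) (lam : Vec Np) (z : ℕ → Sample Np Nm)
    (t : ℕ) : (sbcdIter s I J l μ 0 θ w lam z t).1 = w := by
  induction t with
  | zero => rfl
  | succ t ih => simp [sbcdIter, sbcdStep, proxStep_zero hμ, ih]

theorem sbcdIter_snd_of_theta_zero (w : Vec d) (lam : Vec Np) (z : ℕ → Sample Np Nm)
    (t : ℕ) : (sbcdIter s I J l μ η 0 w lam z t).2 = lam := by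
  induction t with
  | zero => rfl
  | succ t ih =>
    ext i
    simp [sbcdIter, sbcdStep, ih]

/-- Convexity of the inner objective, applied to the averaged iterate. -/
theorem SmoothLosses.gap_average_le (hs : SmoothLosses s m n L B) (hμ : 0 < μ)
    (hρ : Np * Nm * L < μ⁻¹) (w : Vec d) (x : ℕ → Vec d × Vec Np) {T : ℕ} (hT : 0 < T) :
    T * gap s l μ w ((T : ℝ)⁻¹ • ∑ t ∈ Finset.range T, x t)
      ≤ ∑ t ∈ Finset.range T, gap s l μ w (x t) := by
  set y : Vec d × Vec Np := (T : ℝ)⁻¹ • ∑ t ∈ Finset.range T, x t with hy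
  have hT' : (T : ℝ) ≠ 0 := by exact_mod_cast hT.ne'
  have hsum : ∑ t ∈ Finset.range T, (x t - y) = 0 := by
    rw [Finset.sum_sub_distrib, Finset.sum_const, Finset.card_range, hy, ← Nat.cast_smul_eq_nsmul ℝ,
      smul_smul, mul_inv_cancel₀ hT', one_smul, sub_self]
  have hs1 : ∑ t ∈ Finset.range T, ((x t).1 - y.1) = 0 := by
    have := congrArg Prod.fst hsum
    simpa [Prod.fst_sum] using this
  have hs2 : ∀ i, ∑ t ∈ Finset.range T, ((x t).2 i - y.2 i) = 0 := fun i => by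
    have := congrArg (fun p : Vec d × Vec Np => p.2 i) hsum
    simpa [Prod.snd_sum] using this
  -- Subgradient inequality at the average `y`: the quadratic around `w` absorbs the curvature loss,
  -- and the linear terms sum to zero over `t`.
  have key : ∀ t, gap s l μ w y + inner ℝ (subgradV s y.1 y.2 + μ⁻¹ • (y.1 - w)) ((x t).1 - y.1)
      + ∑ i, subgradLam s l y.1 y.2 i * ((x t).2 i - y.2 i) ≤ gap s l μ w (x t) := by
    intro t
    have h1 := hs.gFun_add_le l y.1 (x t).1 y.2 (x t).2
    have h2 := norm_sub_sq_add_smul y.1 w ((x t).1 - y.1) 1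
    rw [one_smul, add_sub_cancel] at h2
    have h3 : ‖(x t).1 - w‖ ^ 2 / (2 * μ) = ‖y.1 - w‖ ^ 2 / (2 * μ)
        + μ⁻¹ * inner ℝ (y.1 - w) ((x t).1 - y.1) + μ⁻¹ / 2 * ‖(x t).1 - y.1‖ ^ 2 := by
      rw [h2]
      field_simp
    have h4 : Np * Nm * L / 2 * ‖(x t).1 - y.1‖ ^ 2 ≤ μ⁻¹ / 2 * ‖(x t).1 - y.1‖ ^ 2 := by gcongr
    rw [inner_add_left, real_inner_smul_left]
    unfold gap
    linarith
  have h := Finset.sum_le_sum fun t (_ : t ∈ Finset.range T) => key t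
  rw [Finset.sum_add_distrib, Finset.sum_add_distrib, ← inner_sum, hs1, inner_zero_right,
    Finset.sum_comm] at h
  simp only [← Finset.mul_sum, hs2, mul_zero, Finset.sum_const_zero, add_zero] at h
  simpa using h

end Step

/-! ### Functions of finitely many draws -/

/-- `Sample` as a product. -/
def Sample.equivProd (Np Nm : ℕ) : Sample Np Nm ≃ Finset (Fin Np) × Finset (Fin Nm) where
  toFun z := (z.rows, z.cols)
  invFun p := ⟨p.1, p.2⟩
  left_inv _ := rfl
  right_inv _ := rfl

instance (Np Nm : ℕ) : Fintype (Sample Np Nm) := Fintype.ofEquiv _ (Sample.equivProd Np Nm).symm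

instance (Np Nm : ℕ) : Nonempty (Sample Np Nm) := ⟨⟨∅, ∅⟩⟩

theorem sum_sample {Np Nm : ℕ} (h : Sample Np Nm → ℝ) :
    ∑ z, h z = ∑ A : Finset (Fin Np), ∑ C : Finset (Fin Nm), h ⟨A, C⟩ := by
  rw [← Fintype.sum_prod_type', ← (Sample.equivProd Np Nm).symm.sum_comp]
  rfl

/-- `f` depends on finitely many draws only. -/
def FinDep {Np Nm : ℕ} {β : Type*} (f : (ℕ × Bool × ℕ → Sample Np Nm) → β) : Prop :=
  ∃ F : Finset (ℕ × Bool × ℕ), DependsOn f (F : Set (ℕ × Bool × ℕ))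

section Prob

variable {Np Nm I J K : ℕ} {β β' : Type*} {Ω : Type*} [MeasurableSpace Ω] {P : Measure Ω}
  [IsProbabilityMeasure P] {Z : ℕ × Bool × ℕ → Ω → Sample Np Nm}

theorem FinDep.comp {f : (ℕ × Bool × ℕ → Sample Np Nm) → β} (hf : FinDep f) (g : β → β') :
    FinDep fun z => g (f z) :=
  hf.imp fun _ h _ _ hxy => congrArg g (h hxy)

/-- Such a function factors through a finite discrete space. Hence no measurability of proximal
points, distances or chosen minimizers has to be checked. -/
theorem FinDep.integrable {E : Type*} [NormedAddCommGroup E]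
    {f : (ℕ × Bool × ℕ → Sample Np Nm) → E} (hf : FinDep f) (hZ : ∀ q, Measurable (Z q)) :
    Integrable (fun ω => f fun q => Z q ω) P := by
  obtain ⟨F, hF⟩ := hf
  obtain ⟨g, rfl⟩ := dependsOn_iff_exists_comp.1 hF
  have hm : Measurable fun ω (i : (F : Set (ℕ × Bool × ℕ))) => Z i ω :=
    measurable_pi_lambda _ fun i => hZ i
  have := Measure.isProbabilityMeasure_map (μ := P) hm.aemeasurable
  exact (Integrable.of_finite (f := g)).comp_measurable hm

theorem FinDep.measurable {f : (ℕ × Bool × ℕ → Sample Np Nm) → ℝ} (hf : FinDep f) :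
    Measurable f := by
  obtain ⟨F, hF⟩ := hf
  obtain ⟨g, rfl⟩ := dependsOn_iff_exists_comp.1 hF
  exact (Measurable.of_discrete (f := g)).comp (measurable_pi_lambda _ fun i => measurable_pi_apply _)

theorem sum_mul_ite_eq_sampleAvg (c : Sample Np Nm → ℝ) :
    ∑ z : Sample Np Nm, c z * (if z.rows.card = I ∧ z.cols.card = J then
      1 / (Np.choose I * Nm.choose J : ℝ) else 0) = sampleAvg I J c := by
  rw [sum_sample, sampleAvg, Finset.mul_sum,
    Finset.powersetCard_eq_filter, Finset.sum_filter, Finset.powerset_univ]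
  refine Finset.sum_congr rfl fun A _ => ?_
  split_ifs with hA
  · rw [Finset.mul_sum, Finset.powersetCard_eq_filter, Finset.sum_filter, Finset.powerset_univ]
    refine Finset.sum_congr rfl fun C _ => ?_
    by_cases hC : C.card = J
    · simp [hA, hC, mul_comm]
    · simp [hC]
  · simp [hA]

/-- The masses prescribed for draws of the right sizes already sum to one, so every other draw is
null. -/
theorem UniformDraws.measureReal_eq (hZ : UniformDraws P I J Z) (hI : I ≤ Np) (hJ : J ≤ Nm)
    (q : ℕ × Bool × ℕ) (z : Sample Np Nm) :
    P.real (Z q ⁻¹' {z}) = if z.rows.card = I ∧ z.cols.card = J then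
      1 / (Np.choose I * Nm.choose J : ℝ) else 0 := by
  have hle : ∀ z ∈ Finset.univ, (if z.rows.card = I ∧ z.cols.card = J then
      1 / (Np.choose I * Nm.choose J : ℝ) else 0) ≤ P.real (Z q ⁻¹' {z}) := by
    intro z _
    split_ifs with h
    · exact (hZ.uniform q z.rows z.cols h.1 h.2).ge
    · exact measureReal_nonneg
  have h1 : ∑ z : Sample Np Nm, P.real (Z q ⁻¹' {z}) = 1 := by
    rw [sum_measureReal_preimage_singleton _ fun y _ => hZ.measurable q (measurableSet_singleton y)]
    simp
  have h2 : ∑ z : Sample Np Nm, (if z.rows.card = I ∧ z.cols.card = J then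
      1 / (Np.choose I * Nm.choose J : ℝ) else 0) = 1 := by
    have h := sum_mul_ite_eq_sampleAvg (I := I) (J := J) (fun _ : Sample Np Nm => (1 : ℝ) - 0)
    rw [sampleAvg_const_sub hI hJ] at h
    simpa [sampleAvg] using h
  exact ((Finset.sum_eq_sum_iff_of_le hle).1 (h2.trans h1.symm) z (Finset.mem_univ z)).symm

/-- A draw that is independent of the other arguments can be averaged out. -/
theorem UniformDraws.integral_eq_integral_sampleAvg (hZ : UniformDraws P I J Z) (hI : I ≤ Np)
    (hJ : J ≤ Nm) {F : Finset (ℕ × Bool × ℕ)} {q : ℕ × Bool × ℕ} (hq : q ∉ F)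
    {Φ : (ℕ × Bool × ℕ → Sample Np Nm) → Sample Np Nm → ℝ}
    (hΦ : ∀ a, DependsOn (fun z => Φ z a) (F : Set (ℕ × Bool × ℕ))) :
    ∫ ω, Φ (fun q => Z q ω) (Z q ω) ∂P = ∫ ω, sampleAvg I J (Φ fun q => Z q ω) ∂P := by
  classical
  have hint : ∀ a, Integrable (fun ω => Φ (fun q => Z q ω) a) P := fun a =>
    FinDep.integrable ⟨F, hΦ a⟩ hZ.measurable
  -- Split by the value of the new draw; each event is independent of its coefficient, which depends
  -- on `F` only.
  have e1 : ∀ ω, Φ (fun q => Z q ω) (Z q ω)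
      = ∑ a, Φ (fun q => Z q ω) a * (Z q ⁻¹' {a}).indicator 1 ω := by
    intro ω
    rw [Finset.sum_eq_single (Z q ω)]
    · simp
    · intro a _ ha
      simp [ha.symm]
    · simp
  have hind : ∀ a, IndepFun (fun ω => Φ (fun q => Z q ω) a) ((Z q ⁻¹' {a}).indicator (1 : Ω → ℝ))
      P := by
    intro a
    obtain ⟨g, hg⟩ := dependsOn_iff_exists_comp.1 (hΦ a)
    have h := hZ.indep.indepFun_finset F {q} (by simpa using hq) hZ.measurable
    have h2 := h.comp (φ := g) (ψ := fun y => ({a} : Set (Sample Np Nm)).indicator (1 : Sample Np Nm → ℝ)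
      (y ⟨q, Finset.mem_singleton_self q⟩)) Measurable.of_discrete Measurable.of_discrete
    have e2 : (fun ω => Φ (fun q => Z q ω) a) = g ∘ fun ω (i : F) => Z i ω := by
      funext ω
      exact congrFun hg fun q => Z q ω
    rw [e2]
    exact h2
  have hmeas : ∀ a, MeasurableSet (Z q ⁻¹' {a}) := fun a =>
    hZ.measurable q (measurableSet_singleton a)
  have e3 : ∀ a, ∫ ω, Φ (fun q => Z q ω) a * (Z q ⁻¹' {a}).indicator 1 ω ∂P
      = (∫ ω, Φ (fun q => Z q ω) a ∂P) * (if a.rows.card = I ∧ a.cols.card = J then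
      1 / (Np.choose I * Nm.choose J : ℝ) else 0) := by
    intro a
    rw [(hind a).integral_fun_mul_eq_mul_integral (hint a).aestronglyMeasurable
      ((stronglyMeasurable_one.indicator (hmeas a)).aestronglyMeasurable),
      integral_indicator_one (hmeas a), hZ.measureReal_eq hI hJ]
  have hint' : ∀ a, Integrable
      (fun ω => Φ (fun q => Z q ω) a * (Z q ⁻¹' {a}).indicator (1 : Ω → ℝ) ω) P := by
    intro a
    refine ((hint a).indicator (hmeas a)).congr (Eventually.of_forall fun ω => ?_)
    by_cases h : Z q ω = a <;> simp [h]
  simp_rw [e1]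
  rw [integral_finsetSum _ fun a _ => hint' a]
  simp_rw [e3]
  rw [sum_mul_ite_eq_sampleAvg]
  simp only [sampleAvg]
  rw [integral_const_mul, integral_finsetSum _ fun A _ => integrable_finsetSum _ fun C _ =>
    hint _]
  simp_rw [integral_finsetSum _ fun C _ => hint _]

theorem UniformIndex.ae_lt {κ : Ω → ℕ} (hκ : UniformIndex P Z K κ) (hK : 1 ≤ K) :
    ∀ᵐ ω ∂P, κ ω < K := by
  have h : P.real (κ ⁻¹' (Finset.range K : Set ℕ)) = 1 := by
    rw [← sum_measureReal_preimage_singleton _ fun y _ =>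
      hκ.measurable (measurableSet_singleton y)]
    have hu : ∀ k ∈ Finset.range K, P.real (κ ⁻¹' {k}) = 1 / (K : ℝ) := fun k hk =>
      hκ.uniform k (Finset.mem_range.1 hk)
    rw [Finset.sum_congr rfl hu]
    have : (K : ℝ) ≠ 0 := by exact_mod_cast (by omega : K ≠ 0)
    simp [this]
  have h2 : P (κ ⁻¹' (Finset.range K : Set ℕ)) = 1 := by
    rw [← ENNReal.toReal_eq_one_iff]
    exact h
  have h3 := (prob_compl_eq_zero_iff (hκ.measurable (Finset.range K).measurableSet)).2 h2
  filter_upwards [compl_mem_ae_iff.2 h3] with ω hω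
  simpa using hω

theorem UniformIndex.ae_eq_sum {E : Type*} [NormedAddCommGroup E] {κ : Ω → ℕ}
    (hκ : UniformIndex P Z K κ) (hK : 1 ≤ K) (Ψ : ℕ → Ω → E) :
    (fun ω => Ψ (κ ω) ω) =ᵐ[P] fun ω => ∑ k ∈ Finset.range K, (κ ⁻¹' {k}).indicator (Ψ k) ω := by
  filter_upwards [hκ.ae_lt hK] with ω hω
  rw [Finset.sum_eq_single (κ ω)]
  · simp
  · intro k _ hk
    simp [hk.symm]
  · intro h
    exact absurd (Finset.mem_range.2 hω) h

theorem UniformIndex.integrable {E : Type*} [NormedAddCommGroup E] {κ : Ω → ℕ}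
    (hκ : UniformIndex P Z K κ) (hK : 1 ≤ K) {Ψ : ℕ → Ω → E} (hΨ : ∀ k, Integrable (Ψ k) P) :
    Integrable (fun ω => Ψ (κ ω) ω) P := by
  rw [integrable_congr (hκ.ae_eq_sum hK Ψ)]
  exact integrable_finsetSum _ fun k _ =>
    (hΨ k).indicator (hκ.measurable (measurableSet_singleton k))

theorem UniformIndex.integral_eq {κ : Ω → ℕ} (hκ : UniformIndex P Z K κ)
    (hZ : ∀ q, Measurable (Z q)) (hK : 1 ≤ K)
    {Ψ : ℕ → (ℕ × Bool × ℕ → Sample Np Nm) → ℝ} (hΨ : ∀ k, FinDep (Ψ k)) :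
    ∫ ω, Ψ (κ ω) (fun q => Z q ω) ∂P
      = 1 / K * ∑ k ∈ Finset.range K, ∫ ω, Ψ k (fun q => Z q ω) ∂P := by
  have hmeas : ∀ k, MeasurableSet (κ ⁻¹' {k}) := fun k => hκ.measurable (measurableSet_singleton k)
  rw [integral_congr_ae (hκ.ae_eq_sum hK fun k ω => Ψ k fun q => Z q ω),
    integral_finsetSum _ fun k _ => ((hΨ k).integrable hZ).indicator (hmeas k), Finset.mul_sum]
  refine Finset.sum_congr rfl fun k hk => ?_
  have hind : IndepFun ((κ ⁻¹' {k}).indicator (1 : Ω → ℝ)) (fun ω => Ψ k fun q => Z q ω) P :=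
    hκ.indep.comp (φ := ({k} : Set ℕ).indicator (1 : ℕ → ℝ)) Measurable.of_discrete
      (hΨ k).measurable
  have e : ∀ ω, (κ ⁻¹' {k}).indicator (fun ω => Ψ k fun q => Z q ω) ω
      = (κ ⁻¹' {k}).indicator (1 : Ω → ℝ) ω * Ψ k fun q => Z q ω := by
    intro ω
    by_cases h : ω ∈ κ ⁻¹' {k} <;> simp [h]
  simp_rw [e]
  rw [hind.integral_fun_mul_eq_mul_integral
    ((stronglyMeasurable_one.indicator (hmeas k)).aestronglyMeasurable)
    ((hΨ k).integrable hZ).aestronglyMeasurable, integral_indicator_one (hmeas k)]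
  congr 1
  exact hκ.uniform k (Finset.mem_range.1 hk)

end Prob

/-! ### Dependence of the iterates on the draws -/

theorem sbcdIter_congr {d Np Nm : ℕ} {s : Fin Np → Fin Nm → Vec d → ℝ} {I J l : ℕ} {μ η θ : ℝ}
    {w : Vec d} {lam : Vec Np} {z z' : ℕ → Sample Np Nm} {t : ℕ} (h : ∀ i < t, z i = z' i) :
    sbcdIter s I J l μ η θ w lam z t = sbcdIter s I J l μ η θ w lam z' t := by
  induction t with
  | zero => rfl
  | succ t ih =>
    simp only [sbcdIter]
    rw [ih fun i hi => h i (hi.trans t.lt_succ_self), h t t.lt_succ_self]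

theorem sbcd_congr {d Np Nm : ℕ} {s : Fin Np → Fin Nm → Vec d → ℝ} {I J l : ℕ} {μ η θ : ℝ}
    {w : Vec d} {lam : Vec Np} {z z' : ℕ → Sample Np Nm} {T : ℕ} (h : ∀ i < T, z i = z' i) :
    sbcd s I J l μ η θ w lam T z = sbcd s I J l μ η θ w lam T z' := by
  unfold sbcd
  rw [Finset.sum_congr rfl fun t ht =>
    sbcdIter_congr fun i hi => h i (hi.trans (Finset.mem_range.1 ht))]

theorem div_sqrt_le {X Y R : ℝ} (hR : 0 ≤ R) (hY : 0 < Y) (h : X ^ 2 ≤ R ^ 2 * Y) :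
    X / √Y ≤ R := by
  rw [div_le_iff₀ (Real.sqrt_pos.2 hY)]
  refine (le_abs_self X).trans (abs_le_of_sq_le_sq ?_ (by positivity))
  rwa [mul_pow, Real.sq_sqrt hY.le]

namespace Setup

variable {d Np Nm : ℕ} (S : Setup d Np Nm)

/-- The standing assumptions on the parameters. -/
structure Admissible : Prop where
  m_lt_n : S.m < S.n
  n_le : S.n ≤ Nm
  one_le_I : 1 ≤ S.I
  I_le : S.I ≤ Np
  one_le_J : 1 ≤ S.J
  J_le : S.J ≤ Nm
  smooth : SmoothLosses S.s S.m S.n S.L S.B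
  mu_pos : 0 < S.μ
  rho_lt : S.ρ < S.μ⁻¹
  gamma_pos : 0 < S.γ
  gamma_le : S.γ ≤ 1 / S.Lmu

/-- The output of the call of SBCD for the inner problem `b` in outer iteration `k`. -/
def out (b : Bool) (z : ℕ × Bool × ℕ → Sample Np Nm) (k : ℕ) : Vec d × Vec Np :=
  S.innerCall b k (S.agd z k).1 ((S.agd z k).2 b) (fun t => z (k, b, t))

/-- The suboptimality of the output of SBCD. -/
def outGap (b : Bool) (z : ℕ × Bool × ℕ → Sample Np Nm) (k : ℕ) : ℝ :=
  gap S.s (S.lev b) S.μ (S.agd z k).1 (S.out b z k)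

/-- The distance of the output of SBCD to the exact proximal point. -/
def err (b : Bool) (z : ℕ × Bool × ℕ → Sample Np Nm) (k : ℕ) : ℝ :=
  ‖(S.out b z k).1 - S.proxL b (S.agd z k).1‖

/-- The distance of the dual iterate to the minimizers at the exact proximal point. -/
def dualDist (b : Bool) (z : ℕ × Bool × ℕ → Sample Np Nm) (k : ℕ) : ℝ :=
  S.distLam b (S.agd z k).1 ((S.agd z k).2 b)

/-- A finite set that contains the indices of all draws made before outer iteration `k`. -/
def pastIdx (k : ℕ) : Finset (ℕ × Bool × ℕ) :=
  Finset.range k ×ˢ (Finset.univ ×ˢ Finset.range (S.totalInner k))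

/-- Shows that the box `pastIdx` is large enough to hold the draws of every past inner call. -/
theorem T_le_totalInner (b : Bool) {k K : ℕ} (h : k < K) : S.T b k ≤ S.totalInner K := by
  have h1 : S.T b k ≤ S.T false k + S.T true k := by cases b <;> omega
  exact h1.trans (Finset.single_le_sum (f := fun k => S.T false k + S.T true k)
    (fun _ _ => Nat.zero_le _) (Finset.mem_range.2 h))

theorem pastIdx_mono (k : ℕ) : S.pastIdx k ⊆ S.pastIdx (k + 1) := by
  refine Finset.product_subset_product (Finset.range_subset_range.2 k.le_succ)
    (Finset.product_subset_product_right (Finset.range_subset_range.2 ?_))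
  exact Finset.sum_le_sum_of_subset (Finset.range_subset_range.2 k.le_succ)

theorem out_congr (b : Bool) (k : ℕ) {z z' : ℕ × Bool × ℕ → Sample Np Nm}
    (h : S.agd z k = S.agd z' k) (hz : ∀ i ∈ S.pastIdx (k + 1), z i = z' i) :
    S.out b z k = S.out b z' k := by
  unfold out innerCall
  rw [h]
  refine sbcd_congr fun t ht => hz _ ?_
  simp only [pastIdx, Finset.mem_product, Finset.mem_range, Finset.mem_univ, true_and]
  exact ⟨k.lt_succ_self, ht.trans_le (S.T_le_totalInner b k.lt_succ_self)⟩

theorem agd_succ (z : ℕ × Bool × ℕ → Sample Np Nm) (k : ℕ) :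
    S.agd z (k + 1) = ((S.agd z k).1 - (S.γ * S.μ⁻¹) • ((S.out false z k).1 - (S.out true z k).1),
      fun b => (S.out b z k).2) := rfl

theorem dependsOn_agd (k : ℕ) : DependsOn (fun z => S.agd z k)
    (S.pastIdx k : Set (ℕ × Bool × ℕ)) := by
  induction k with
  | zero => exact fun _ _ _ => rfl
  | succ k ih =>
    intro z z' h
    have h1 : S.agd z k = S.agd z' k := ih fun i hi => h i (S.pastIdx_mono k hi)
    simp only [agd_succ]
    rw [h1, S.out_congr false k h1 h, S.out_congr true k h1 h]
    congr 1
    funext b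
    rw [S.out_congr b k h1 h]

/-- The iterates before and the outputs of an outer iteration depend on finitely many draws. -/
theorem finDep_state (k : ℕ) :
    FinDep fun z => (S.agd z k, fun b => S.out b z k) := by
  refine ⟨S.pastIdx (k + 1), fun z z' h => ?_⟩
  have h1 : S.agd z k = S.agd z' k := S.dependsOn_agd k fun i hi => h i (S.pastIdx_mono k hi)
  dsimp only
  rw [h1]
  congr 1
  funext b
  exact S.out_congr b k h1 h

theorem finDep_outGap (b : Bool) (k : ℕ) : FinDep fun z => S.outGap b z k :=
  (S.finDep_state k).comp fun p => gap S.s (S.lev b) S.μ p.1.1 (p.2 b)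

theorem finDep_err (b : Bool) (k : ℕ) : FinDep fun z => S.err b z k :=
  (S.finDep_state k).comp fun p => ‖(p.2 b).1 - S.proxL b p.1.1‖

theorem finDep_dualDist (b : Bool) (k : ℕ) : FinDep fun z => S.dualDist b z k :=
  (S.finDep_state k).comp fun p => S.distLam b p.1.1 (p.1.2 b)

/-! ### Consequences of the choice of parameters -/

namespace Admissible

variable {S}

theorem Np_pos (hS : S.Admissible) : (0 : ℝ) < Np := by
  exact_mod_cast hS.one_le_I.trans hS.I_le

theorem Nm_pos (hS : S.Admissible) : (0 : ℝ) < Nm := by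
  exact_mod_cast hS.one_le_J.trans hS.J_le

theorem I_pos (hS : S.Admissible) : (0 : ℝ) < S.I := by
  exact_mod_cast hS.one_le_I

theorem lev_le (hS : S.Admissible) (b : Bool) : S.lev b ≤ Nm := by
  cases b
  · exact hS.m_lt_n.le.trans hS.n_le
  · exact hS.n_le

theorem rho_nonneg (hS : S.Admissible) : 0 ≤ S.ρ := by
  have := hS.smooth.L_nonneg
  unfold Setup.ρ
  positivity

theorem mu_mul_rho_lt (hS : S.Admissible) : S.μ * S.ρ < 1 := by
  have := mul_lt_mul_of_pos_left hS.rho_lt hS.mu_pos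
  rwa [mul_inv_cancel₀ hS.mu_pos.ne'] at this

theorem M_nonneg (hS : S.Admissible) (b : Bool) : 0 ≤ Np * S.lev b * S.B := by
  have := hS.smooth.B_nonneg
  positivity

theorem wcl (hS : S.Admissible) (b : Bool) :
    WeaklyConvexLipschitz (fTop S.s (S.lev b)) S.ρ (Np * S.lev b * S.B) :=
  hS.smooth.weaklyConvexLipschitz (hS.lev_le b)

theorem norm_proxL_sub_le (hS : S.Admissible) (b : Bool) (w : Vec d) :
    ‖S.proxL b w - w‖ ≤ S.μ * (Np * S.lev b * S.B) :=
  (hS.wcl b).norm_prox_sub_le hS.mu_pos w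

/-- The bracket is the curvature constant in `smoothObj_descent`; it equals `Lmu / 2`. -/
theorem gamma_mul_le (hS : S.Admissible) :
    S.γ * (S.μ⁻¹ + S.ρ / (1 - S.μ * S.ρ)) ≤ 1 := by
  have hμ := hS.mu_pos
  have h1 : 0 < 1 - S.μ * S.ρ := by linarith [hS.mu_mul_rho_lt]
  have h2 := hS.gamma_le
  have h3 : S.μ - S.μ ^ 2 * S.ρ = S.μ * (1 - S.μ * S.ρ) := by ring
  rw [Lmu, h3, one_div_div, le_div_iff₀ two_pos] at h2
  have h4 : S.μ⁻¹ + S.ρ / (1 - S.μ * S.ρ) = 1 / (S.μ * (1 - S.μ * S.ρ)) := by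
    field_simp
    ring
  rw [h4, mul_one_div, div_le_one (by positivity)]
  nlinarith [hS.gamma_pos]

theorem D_pos (hS : S.Admissible) (b : Bool) : 0 < S.D b := by
  refine lt_of_lt_of_le ?_ (le_max_right _ _)
  have h1 : 0 < 1 - S.μ * S.ρ := by linarith [hS.mu_mul_rho_lt]
  have h2 : 0 < 1 / S.μ - S.ρ := by rw [one_div]; linarith [hS.rho_lt]
  have := hS.mu_pos
  have := hS.gamma_pos
  have := hS.smooth.B_nonneg
  positivity

theorem T_pos (hS : S.Admissible) (b : Bool) (k : ℕ) : 0 < S.T b k := by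
  have h2 : 0 < S.μ⁻¹ - S.ρ := by linarith [hS.rho_lt]
  have := hS.D_pos b
  have := hS.Np_pos
  have := hS.Nm_pos
  have := hS.I_pos
  refine Nat.ceil_pos.2 (lt_of_lt_of_le ?_ ((le_max_left _ _).trans (le_max_left _ _)))
  positivity

/-- The contribution of the dual variables to the error of SBCD. -/
theorem dual_error_le (hS : S.Admissible) (b : Bool) (k : ℕ) :
    Np * Nm * S.D b / √(S.I * S.T b k) ≤ (S.μ⁻¹ - S.ρ) / (12 * (k + 1)) := by
  have h2 : 0 < S.μ⁻¹ - S.ρ := by linarith [hS.rho_lt]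
  have hI := hS.I_pos
  have hT : (0 : ℝ) < S.T b k := by exact_mod_cast hS.T_pos b k
  refine div_sqrt_le (by positivity) (by positivity) ?_
  have h : 144 * Np ^ 2 * Nm ^ 2 * S.D b ^ 2 * ((k : ℝ) + 1) ^ 2 / (S.I * (S.μ⁻¹ - S.ρ) ^ 2)
      ≤ S.T b k := ((le_max_left _ _).trans (le_max_left _ _)).trans (Nat.le_ceil _)
  rw [div_le_iff₀ (by positivity)] at h
  rw [div_pow, div_mul_eq_mul_div, le_div_iff₀ (by positivity)]
  linarith

/-- The contribution of the primal variable to the error of SBCD. -/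
theorem primal_error_le (hS : S.Admissible) (b : Bool) (k : ℕ) :
    S.μ * (Np * S.lev b * S.B) * (Np * Nm * S.B) / √(S.T b k)
      ≤ (S.μ⁻¹ - S.ρ) / (4 * (k + 1)) := by
  have h2 : 0 < S.μ⁻¹ - S.ρ := by linarith [hS.rho_lt]
  have hT : (0 : ℝ) < S.T b k := by exact_mod_cast hS.T_pos b k
  refine div_sqrt_le (by positivity) (by positivity) ?_
  have h : 16 * Np ^ 2 * Nm ^ 2 * S.μ ^ 2 * (Np * S.lev b * S.B) ^ 2 * S.B ^ 2 * ((k : ℝ) + 1) ^ 2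
        / (S.μ⁻¹ - S.ρ) ^ 2 ≤ S.T b k :=
    ((le_max_right _ _).trans (le_max_left _ _)).trans (Nat.le_ceil _)
  rw [div_le_iff₀ (by positivity)] at h
  rw [div_pow, div_mul_eq_mul_div, le_div_iff₀ (by positivity)]
  linarith

/-- The contribution of the weak convexity to the error of SBCD. -/
theorem curvature_error_le (hS : S.Admissible) (b : Bool) (k : ℕ) :
    S.ρ / 2 * (S.μ * (Np * S.lev b * S.B)) ^ 2 / S.T b k ≤ (S.μ⁻¹ - S.ρ) / (6 * (k + 1)) := by
  have h2 : 0 < S.μ⁻¹ - S.ρ := by linarith [hS.rho_lt]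
  have hT : (0 : ℝ) < S.T b k := by exact_mod_cast hS.T_pos b k
  have hμ := hS.mu_pos
  have h : 6 * S.μ * (Np * S.lev b * S.B) ^ 2 * ((k : ℝ) + 1) / (2 * (S.μ⁻¹ - S.ρ)) ≤ S.T b k :=
    (le_max_right _ _).trans (Nat.le_ceil _)
  rw [div_le_iff₀ (by positivity)] at h
  rw [div_le_div_iff₀ hT (by positivity)]
  have h3 : S.ρ * S.μ * (S.μ * (Np * S.lev b * S.B) ^ 2 * (k + 1))
      ≤ 1 * (S.μ * (Np * S.lev b * S.B) ^ 2 * (k + 1)) := by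
    refine mul_le_mul_of_nonneg_right ?_ (by positivity)
    linarith [hS.mu_mul_rho_lt]
  linarith

/-! ### Convergence of SBCD in one outer iteration -/

/-- The step sizes balance the initial distances against the accumulated noise: `η` equates `r ^ 2 /
(2 * η)` with its noise term over `T` steps, and `θ` does the same for the dual distance. That
distance stays explicit because only its mean is controlled. -/
theorem potential_sum_le (hS : S.Admissible) (b : Bool) (k : ℕ) (w vs : Vec d) (lam lams : Vec Np)
    (hvs : vs = S.proxL b w) (hlams : dist lam lams = S.distLam b w lam) :
    potential S.I S.μ S.ρ (S.stepη b k w) (S.stepθ b k w lam) w vs lams (w, lam)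
      + S.T b k * (S.stepη b k w / 2 * (Np * Nm * S.B) ^ 2
        + S.stepθ b k w lam * Np * Nm ^ 2 / 2)
      ≤ S.T b k * ((S.μ⁻¹ - S.ρ) / (6 * (k + 1)) + (S.μ⁻¹ - S.ρ) / (4 * (k + 1))
        + Np * Nm * S.distLam b w lam / √(S.I * S.T b k)) := by
  have hT : (0 : ℝ) < S.T b k := by exact_mod_cast hS.T_pos b k
  have hr := hS.norm_proxL_sub_le b w
  have hNp := hS.Np_pos
  have hNm := hS.Nm_pos
  have hI := hS.I_pos
  have hB := hS.smooth.B_nonneg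
  have hρ := hS.rho_nonneg
  set r := ‖S.proxL b w - w‖ with hr'
  set δ := S.distLam b w lam with hδ
  set R := √(S.T b k : ℝ) with hR
  set Q := √(S.I * S.T b k : ℝ) with hQ
  have hRpos : 0 < R := Real.sqrt_pos.2 hT
  have hQpos : 0 < Q := Real.sqrt_pos.2 (by positivity)
  have hR2 : (S.T b k : ℝ) = R * R := (Real.mul_self_sqrt hT.le).symm
  have hQ2 : (S.T b k : ℝ) = Q * Q / S.I := by
    rw [Real.mul_self_sqrt (by positivity)]
    field_simp
  have e1 : S.ρ / 2 * r ^ 2 ≤ S.T b k * ((S.μ⁻¹ - S.ρ) / (6 * (k + 1))) := by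
    have h := hS.curvature_error_le b k
    rw [div_le_iff₀ hT] at h
    have : S.ρ / 2 * r ^ 2 ≤ S.ρ / 2 * (S.μ * (Np * S.lev b * S.B)) ^ 2 := by gcongr
    linarith
  have e2 : r ^ 2 / (2 * S.stepη b k w) + S.T b k * (S.stepη b k w / 2 * (Np * Nm * S.B) ^ 2)
      ≤ S.T b k * ((S.μ⁻¹ - S.ρ) / (4 * (k + 1))) := by
    refine le_trans (le_of_eq ?_) (mul_le_mul_of_nonneg_left ((div_le_div_of_nonneg_right
      (mul_le_mul_of_nonneg_right hr (by positivity : 0 ≤ Np * Nm * S.B)) hRpos.le).trans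
      (hS.primal_error_le b k)) hT.le)
    rcases hB.eq_or_lt with hB0 | hB0
    · have : r = 0 := le_antisymm (by simpa [← hB0] using hr) (norm_nonneg _)
      simp [stepη, ← hr', this]
    · rcases (norm_nonneg (S.proxL b w - w)).eq_or_lt with h0 | h0
      · rw [← hr'] at h0
        simp [stepη, ← hr', ← h0]
      · rw [← hr'] at h0
        rw [stepη, ← hr', ← hR, hR2]
        field_simp
        ring
  have e3 : Np / (2 * S.stepθ b k w lam * S.I) * δ ^ 2
      + S.T b k * (S.stepθ b k w lam * Np * Nm ^ 2 / 2) = S.T b k * (Np * Nm * δ / Q) := by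
    have hδ0 : 0 ≤ δ := Metric.infDist_nonneg
    rcases hδ0.eq_or_lt with h0 | h0
    · simp [stepθ, ← hδ, ← h0]
    · rw [stepθ, ← hδ, ← hQ, hQ2]
      field_simp
      ring
  have e4 : potential S.I S.μ S.ρ (S.stepη b k w) (S.stepθ b k w lam) w vs lams (w, lam)
      = S.ρ / 2 * r ^ 2 + r ^ 2 / (2 * S.stepη b k w)
        + Np / (2 * S.stepθ b k w lam * S.I) * δ ^ 2 := by
    have h1 : ‖w - vs‖ = r := by rw [hvs, norm_sub_rev]
    have h2 : ‖lam - lams‖ = δ := by rw [← hlams, dist_eq_norm]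
    simp [potential, h1, h2]
  rw [e4]
  linarith

/-- In expectation, SBCD in outer iteration `k` is `(1/μ - ρ) / (2 (k + 1))`-accurate. -/
theorem integral_outGap_le (hS : S.Admissible) {Ω : Type*} [MeasurableSpace Ω] {P : Measure Ω}
    [IsProbabilityMeasure P] {Z : ℕ × Bool × ℕ → Ω → Sample Np Nm}
    (hZ : UniformDraws P S.I S.J Z) (b : Bool) (k : ℕ)
    (hD : ∫ ω, S.dualDist b (fun q => Z q ω) k ∂P ≤ S.D b) :
    ∫ ω, S.outGap b (fun q => Z q ω) k ∂P ≤ (S.μ⁻¹ - S.ρ) / (2 * (k + 1)) := by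
  have hμ := hS.mu_pos
  have hT : (0 : ℝ) < S.T b k := by exact_mod_cast hS.T_pos b k
  have hNp := hS.Np_pos
  have hNm := hS.Nm_pos
  have hI := hS.I_pos
  have hB := hS.smooth.B_nonneg
  -- The dual reference point is a nearest minimizer for the random state before the call, so it
  -- depends on past draws only.
  choose near hnear using fun (w : Vec d) (lam : Vec Np) =>
    hS.smooth.exists_nearest_lam (hS.lev_le b) (S.proxL b w) lam
  -- the iterates, the potential and the error term as functions of the draws
  set x : ℕ → (ℕ × Bool × ℕ → Sample Np Nm) → Vec d × Vec Np := fun t z =>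
    sbcdIter S.s S.I S.J (S.lev b) S.μ (S.stepη b k (S.agd z k).1)
      (S.stepθ b k (S.agd z k).1 ((S.agd z k).2 b)) (S.agd z k).1 ((S.agd z k).2 b)
      (fun t => z (k, b, t)) t with hx
  set V : (ℕ × Bool × ℕ → Sample Np Nm) → Vec d × Vec Np → ℝ := fun z y =>
    potential S.I S.μ S.ρ (S.stepη b k (S.agd z k).1)
      (S.stepθ b k (S.agd z k).1 ((S.agd z k).2 b)) (S.agd z k).1 (S.proxL b (S.agd z k).1)
      (near (S.agd z k).1 ((S.agd z k).2 b)) y with hV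
  set c : (ℕ × Bool × ℕ → Sample Np Nm) → ℝ := fun z =>
    S.stepη b k (S.agd z k).1 / 2 * (Np * Nm * S.B) ^ 2
      + S.stepθ b k (S.agd z k).1 ((S.agd z k).2 b) * Np * Nm ^ 2 / 2 with hc
  set step : (ℕ × Bool × ℕ → Sample Np Nm) → Vec d × Vec Np → Sample Np Nm → Vec d × Vec Np :=
    fun z y a => sbcdStep S.s S.I S.J (S.lev b) S.μ (S.stepη b k (S.agd z k).1)
      (S.stepθ b k (S.agd z k).1 ((S.agd z k).2 b)) (S.agd z k).1 a y with hstep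
  have hηnn : ∀ w, 0 ≤ S.stepη b k w := fun w => by unfold stepη; positivity
  have hθnn : ∀ w lam, 0 ≤ S.stepθ b k w lam := fun w lam => by
    have : 0 ≤ S.distLam b w lam := Metric.infDist_nonneg
    unfold stepθ
    positivity
  -- A zero step size occurs only if the starting point is already optimal in that variable, as the
  -- degenerate cases of the one-step estimate require.
  have hηz : ∀ w, S.stepη b k w = 0 → S.proxL b w = w := by
    intro w h
    have hr := hS.norm_proxL_sub_le b w
    rw [stepη, div_eq_zero_iff] at h
    rcases h with h | h
    · exact sub_eq_zero.1 (norm_eq_zero.1 h)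
    · have hB0 : S.B = 0 := by
        by_contra hne
        have : (0 : ℝ) < S.B := lt_of_le_of_ne hB (Ne.symm hne)
        have : 0 < Np * Nm * S.B * √(S.T b k) := by positivity
        exact this.ne' h
      rw [hB0, mul_zero, mul_zero] at hr
      exact sub_eq_zero.1 (norm_eq_zero.1 (le_antisymm hr (norm_nonneg _)))
  have hθz : ∀ w lam, S.stepθ b k w lam = 0 → lam = near w lam := by
    intro w lam h
    have : 0 < √(S.I * S.T b k : ℝ) * Nm := by positivity
    rw [stepθ, div_eq_zero_iff] at h
    rcases h with h | h
    · exact dist_eq_zero.1 ((hnear w lam).2.trans h)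
    · exact absurd h this.ne'
  -- Iterate `t` uses past outer iterations and the draws of this call with index below `t`; draw
  -- `t` itself is fresh.
  have hpast : ∀ t, DependsOn (fun z => (S.agd z k, x t z)) ((S.pastIdx k ∪
      (Finset.range t).image fun i => (k, b, i) : Finset _) : Set (ℕ × Bool × ℕ)) := by
    intro t z z' h
    have h1 : S.agd z k = S.agd z' k := S.dependsOn_agd k fun i hi =>
      h i (Finset.mem_coe.2 (Finset.mem_union_left _ hi))
    simp only [hx]
    rw [h1]
    congr 1
    exact sbcdIter_congr fun i hi => h _ (Finset.mem_coe.2 (Finset.mem_union_right _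
      (Finset.mem_image_of_mem _ (Finset.mem_range.2 hi))))
  have hnew : ∀ t, (k, b, t) ∉ S.pastIdx k ∪ (Finset.range t).image fun i => (k, b, i) := by
    intro t h
    simp [pastIdx] at h
  have hfin : ∀ t, FinDep fun z => (S.agd z k, x t z) := fun t => ⟨_, hpast t⟩
  have iV : ∀ t, Integrable (fun ω => V (fun q => Z q ω) (x t fun q => Z q ω)) P := fun t =>
    FinDep.integrable ((hfin t).comp fun p => potential S.I S.μ S.ρ (S.stepη b k p.1.1)
      (S.stepθ b k p.1.1 (p.1.2 b)) p.1.1 (S.proxL b p.1.1) (near p.1.1 (p.1.2 b)) p.2)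
      hZ.measurable
  have ic : Integrable (fun ω => c fun q => Z q ω) P :=
    FinDep.integrable ((hfin 0).comp fun p => S.stepη b k p.1.1 / 2 * (Np * Nm * S.B) ^ 2
      + S.stepθ b k p.1.1 (p.1.2 b) * Np * Nm ^ 2 / 2) hZ.measurable
  have ig : ∀ t, Integrable (fun ω => gap S.s (S.lev b) S.μ (S.agd (fun q => Z q ω) k).1
      (x t fun q => Z q ω)) P := fun t =>
    FinDep.integrable ((hfin t).comp fun p => gap S.s (S.lev b) S.μ p.1.1 p.2) hZ.measurable
  have ia : ∀ t, Integrable (fun ω => sampleAvg S.I S.J fun a =>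
      V (fun q => Z q ω) (step (fun q => Z q ω) (x t fun q => Z q ω) a)) P := fun t =>
    FinDep.integrable ((hfin t).comp fun p => sampleAvg S.I S.J fun a =>
      potential S.I S.μ S.ρ (S.stepη b k p.1.1) (S.stepθ b k p.1.1 (p.1.2 b)) p.1.1
        (S.proxL b p.1.1) (near p.1.1 (p.1.2 b)) (sbcdStep S.s S.I S.J (S.lev b) S.μ
          (S.stepη b k p.1.1) (S.stepθ b k p.1.1 (p.1.2 b)) p.1.1 a p.2)) hZ.measurable
  -- one step in expectation
  have hone : ∀ t, ∫ ω, gap S.s (S.lev b) S.μ (S.agd (fun q => Z q ω) k).1 (x t fun q => Z q ω) ∂P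
      + ∫ ω, V (fun q => Z q ω) (x (t + 1) fun q => Z q ω) ∂P
      ≤ ∫ ω, V (fun q => Z q ω) (x t fun q => Z q ω) ∂P + ∫ ω, c (fun q => Z q ω) ∂P := by
    intro t
    have h1 : ∫ ω, V (fun q => Z q ω) (x (t + 1) fun q => Z q ω) ∂P
        = ∫ ω, sampleAvg S.I S.J (fun a =>
          V (fun q => Z q ω) (step (fun q => Z q ω) (x t fun q => Z q ω) a)) ∂P :=
      hZ.integral_eq_integral_sampleAvg hS.I_le hS.J_le (hnew t)
        (Φ := fun z a => V z (step z (x t z) a)) fun a z z' h => by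
          have h := hpast t h
          rw [Prod.mk.injEq] at h
          simp only [hV, hstep, h.1, h.2]
    rw [h1, ← integral_add (ig t) (ia t), ← integral_add (iV t) ic]
    refine integral_mono ((ig t).add (ia t)) ((iV t).add ic) fun ω => ?_
    refine sbcdStep_descent hS.smooth (hS.lev_le b) hS.one_le_I hS.I_le hS.one_le_J hS.J_le hμ
      hS.rho_lt (hnear _ _).1 ?_ ?_
    · rcases (hηnn (S.agd (fun q => Z q ω) k).1).eq_or_lt with h | h
      · refine Or.inr ⟨h.symm, ?_, hηz _ h.symm⟩
        simp only [hx]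
        rw [← h]
        exact sbcdIter_fst_of_eta_zero hμ _ _ _ _
      · exact Or.inl h
    · rcases (hθnn (S.agd (fun q => Z q ω) k).1 ((S.agd (fun q => Z q ω) k).2 b)).eq_or_lt
        with h | h
      · refine Or.inr ⟨h.symm, ?_⟩
        rw [← hθz _ _ h.symm]
        simp only [hx]
        rw [← h]
        exact sbcdIter_snd_of_theta_zero _ _ _ _
      · exact Or.inl h
  have hsum : ∀ N : ℕ, ∑ t ∈ Finset.range N,
      ∫ ω, gap S.s (S.lev b) S.μ (S.agd (fun q => Z q ω) k).1 (x t fun q => Z q ω) ∂P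
      + ∫ ω, V (fun q => Z q ω) (x N fun q => Z q ω) ∂P
      ≤ ∫ ω, V (fun q => Z q ω) (x 0 fun q => Z q ω) ∂P + N * ∫ ω, c (fun q => Z q ω) ∂P := by
    intro N
    induction N with
    | zero => simp
    | succ N ih =>
      rw [Finset.sum_range_succ]
      push_cast
      linarith [hone N]
  have hVnn : 0 ≤ ∫ ω, V (fun q => Z q ω) (x (S.T b k) fun q => Z q ω) ∂P := by
    refine integral_nonneg fun ω => ?_
    have h1 := hηnn (S.agd (fun q => Z q ω) k).1
    have h2 := hθnn (S.agd (fun q => Z q ω) k).1 ((S.agd (fun q => Z q ω) k).2 b)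
    have h3 := hS.rho_nonneg
    simp only [hV, potential, Pi.zero_apply]
    positivity
  have idist : Integrable (fun ω => S.dualDist b (fun q => Z q ω) k) P :=
    (S.finDep_dualDist b k).integrable hZ.measurable
  have hstart : ∫ ω, V (fun q => Z q ω) (x 0 fun q => Z q ω) ∂P
      + S.T b k * ∫ ω, c (fun q => Z q ω) ∂P ≤ S.T b k * ((S.μ⁻¹ - S.ρ) / (2 * (k + 1))) := by
    have h1 : ∫ ω, V (fun q => Z q ω) (x 0 fun q => Z q ω) ∂P
        + S.T b k * ∫ ω, c (fun q => Z q ω) ∂P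
        ≤ ∫ ω, S.T b k * ((S.μ⁻¹ - S.ρ) / (6 * (k + 1)) + (S.μ⁻¹ - S.ρ) / (4 * (k + 1))
          + Np * Nm / √(S.I * S.T b k) * S.dualDist b (fun q => Z q ω) k) ∂P := by
      rw [← integral_const_mul, ← integral_add (iV 0) (ic.const_mul _)]
      refine integral_mono ((iV 0).add (ic.const_mul _))
        (((integrable_const _).add (idist.const_mul _)).const_mul _) fun ω => ?_
      refine (hS.potential_sum_le b k _ _ _ _ rfl (hnear _ _).2).trans (le_of_eq ?_)
      simp only [dualDist]
      ring
    rw [integral_const_mul, integral_add (integrable_const _) (idist.const_mul _),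
      integral_const_mul] at h1
    simp only [integral_const, probReal_univ, one_smul] at h1
    refine h1.trans (mul_le_mul_of_nonneg_left ?_ hT.le)
    have h2 := hS.dual_error_le b k
    have h3 : Np * Nm / √(S.I * S.T b k) * ∫ ω, S.dualDist b (fun q => Z q ω) k ∂P
        ≤ Np * Nm / √(S.I * S.T b k) * S.D b :=
      mul_le_mul_of_nonneg_left hD (by positivity)
    -- The error budget: shares `1/6` for curvature, `1/4` for the primal and `1/12` for the dual
    -- variable add up to `1/2`.
    have h4 : (S.μ⁻¹ - S.ρ) / (6 * (k + 1)) + (S.μ⁻¹ - S.ρ) / (4 * (k + 1))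
        + (S.μ⁻¹ - S.ρ) / (12 * (k + 1)) = (S.μ⁻¹ - S.ρ) / (2 * ((k : ℝ) + 1)) := by
      field_simp
      ring
    rw [div_mul_eq_mul_div, div_mul_eq_mul_div] at h3
    rw [← h4, div_mul_eq_mul_div]
    linarith
  have hjensen : S.T b k * ∫ ω, S.outGap b (fun q => Z q ω) k ∂P ≤ ∑ t ∈ Finset.range (S.T b k),
      ∫ ω, gap S.s (S.lev b) S.μ (S.agd (fun q => Z q ω) k).1 (x t fun q => Z q ω) ∂P := by
    rw [← integral_finsetSum _ fun t _ => ig t, ← integral_const_mul]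
    exact integral_mono (((S.finDep_outGap b k).integrable hZ.measurable).const_mul _)
      (integrable_finsetSum _ fun t _ => ig t) fun ω =>
      hS.smooth.gap_average_le hμ hS.rho_lt _ _ (hS.T_pos b k)
  refine le_of_mul_le_mul_left ?_ hT
  linarith [hsum (S.T b k)]
end Admissible

end Setup

/-! ### Convergence of AGD -/

namespace Setup.Admissible

variable {d Np Nm : ℕ} {S : Setup d Np Nm} {Ω : Type*} [MeasurableSpace Ω] {P : Measure Ω}
  [IsProbabilityMeasure P] {Z : ℕ × Bool × ℕ → Ω → Sample Np Nm}

/-- The suboptimality controls the distance to the proximal point and the dual suboptimality. -/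
theorem err_sq_add_le (hS : S.Admissible) (b : Bool) (z : ℕ × Bool × ℕ → Sample Np Nm) (k : ℕ) :
    (S.μ⁻¹ - S.ρ) / 2 * S.err b z k ^ 2
      + (gFun S.s (S.lev b) (S.out b z k).1 (S.out b z k).2 - fTop S.s (S.lev b) (S.out b z k).1)
      ≤ S.outGap b z k := by
  have h := (hS.wcl b).env_add_le hS.mu_pos (S.agd z k).1 (S.out b z k).1
  unfold outGap err gap proxL
  linarith

theorem half_err_sq_le_outGap (hS : S.Admissible) (b : Bool) (z : ℕ × Bool × ℕ → Sample Np Nm)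
    (k : ℕ) : (S.μ⁻¹ - S.ρ) / 2 * S.err b z k ^ 2 ≤ S.outGap b z k := by
  have h1 := hS.err_sq_add_le b z k
  have h2 := fTop_le_gFun (s := S.s) (hS.lev_le b) (S.out b z k).1 (S.out b z k).2
  linarith

/-- The step is a multiple of the difference of the two inner errors plus the difference of the two
proximal displacements, which are uniformly bounded. -/
theorem norm_step_le (hS : S.Admissible) (z : ℕ × Bool × ℕ → Sample Np Nm) (k : ℕ) :
    ‖(S.agd z (k + 1)).1 - (S.agd z k).1‖ ≤ S.γ * S.μ⁻¹ * (S.err false z k + S.err true z k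
      + (S.μ * (Np * S.m * S.B) + S.μ * (Np * S.n * S.B))) := by
  have h1 := hS.norm_proxL_sub_le false (S.agd z k).1
  have h2 := hS.norm_proxL_sub_le true (S.agd z k).1
  have hγ := hS.gamma_pos
  have hμ := hS.mu_pos
  have h3 : (S.agd z (k + 1)).1 - (S.agd z k).1 = -((S.γ * S.μ⁻¹) •
      (((S.out false z k).1 - S.proxL false (S.agd z k).1)
        - ((S.out true z k).1 - S.proxL true (S.agd z k).1)
        + ((S.proxL false (S.agd z k).1 - (S.agd z k).1)
          - (S.proxL true (S.agd z k).1 - (S.agd z k).1)))) := by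
    rw [Setup.agd_succ]
    module
  rw [h3, norm_neg, norm_smul, Real.norm_eq_abs, abs_of_pos (by positivity)]
  refine mul_le_mul_of_nonneg_left ?_ (by positivity)
  refine (norm_add_le _ _).trans (add_le_add (norm_sub_le _ _) ((norm_sub_le _ _).trans ?_))
  exact add_le_add h1 h2

/-- Sharpness is applied at the inner output. Its distance to the next proximal point is at most the
inner error plus the Lipschitz constant of the proximal map times the outer step. -/
theorem dualDist_succ_le (hS : S.Admissible) (b : Bool) (z : ℕ × Bool × ℕ → Sample Np Nm) (k : ℕ) :
    S.dualDist b z (k + 1) ≤ S.outGap b z k + Np * S.B * (S.err b z k + 1 / (1 - S.μ * S.ρ) *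
      (S.γ * S.μ⁻¹ * (S.err false z k + S.err true z k
        + (S.μ * (Np * S.m * S.B) + S.μ * (Np * S.n * S.B))))) := by
  have h1 := hS.smooth.infDist_lamArgmin_le (hS.lev_le b) (S.out b z k).1
    (S.proxL b (S.agd z (k + 1)).1) (S.out b z k).2
  have h2 := hS.err_sq_add_le b z k
  have h3 : 0 ≤ (S.μ⁻¹ - S.ρ) / 2 * S.err b z k ^ 2 := by
    have := sub_pos.2 hS.rho_lt
    positivity
  have hc : 0 < 1 - S.μ * S.ρ := by linarith [hS.mu_mul_rho_lt]
  have h4 : ‖(S.out b z k).1 - S.proxL b (S.agd z (k + 1)).1‖ ≤ S.err b z k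
      + 1 / (1 - S.μ * S.ρ) * (S.γ * S.μ⁻¹ * (S.err false z k + S.err true z k
        + (S.μ * (Np * S.m * S.B) + S.μ * (Np * S.n * S.B)))) := by
    have h5 := norm_sub_le_norm_sub_add_norm_sub (S.out b z k).1 (S.proxL b (S.agd z k).1)
      (S.proxL b (S.agd z (k + 1)).1)
    have h6 := (hS.wcl b).norm_prox_sub_prox_le hS.mu_pos hS.rho_lt (S.agd z k).1
      (S.agd z (k + 1)).1
    have h7 := mul_le_mul_of_nonneg_left (hS.norm_step_le z k)
      (by positivity : 0 ≤ 1 / (1 - S.μ * S.ρ))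
    rw [norm_sub_rev (S.proxL b (S.agd z k).1)] at h5
    exact h5.trans (add_le_add le_rfl (h6.trans h7))
  have h8 := mul_le_mul_of_nonneg_left h4
    (mul_nonneg (Nat.cast_nonneg (α := ℝ) Np) hS.smooth.B_nonneg)
  rw [mul_assoc] at h8
  have h9 : S.dualDist b z (k + 1) = Metric.infDist (S.out b z k).2
      (lamArgmin S.s (S.lev b) (S.proxL b (S.agd z (k + 1)).1)) := rfl
  rw [h9]
  linarith

theorem integral_err_sq_le_of_outGap (hS : S.Admissible) (hZ : UniformDraws P S.I S.J Z) (b : Bool)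
    (k : ℕ) (h : ∫ ω, S.outGap b (fun q => Z q ω) k ∂P ≤ (S.μ⁻¹ - S.ρ) / (2 * (k + 1))) :
    ∫ ω, S.err b (fun q => Z q ω) k ^ 2 ∂P ≤ 1 / ((k : ℝ) + 1) := by
  have hδ := sub_pos.2 hS.rho_lt
  have h1 : ∫ ω, (S.μ⁻¹ - S.ρ) / 2 * S.err b (fun q => Z q ω) k ^ 2 ∂P
      ≤ ∫ ω, S.outGap b (fun q => Z q ω) k ∂P :=
    integral_mono ((((S.finDep_err b k).comp fun e => e ^ 2).integrable hZ.measurable).const_mul _)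
      ((S.finDep_outGap b k).integrable hZ.measurable) fun ω => hS.half_err_sq_le_outGap b _ k
  rw [integral_const_mul] at h1
  have h2 : (S.μ⁻¹ - S.ρ) / (2 * (k + 1)) = (S.μ⁻¹ - S.ρ) / 2 * (1 / ((k : ℝ) + 1)) := by
    field_simp
  refine le_of_mul_le_mul_left ?_ (half_pos hδ)
  linarith

theorem integral_err_le_one (hZ : UniformDraws P S.I S.J Z) (b : Bool)
    (k : ℕ) (h : ∫ ω, S.err b (fun q => Z q ω) k ^ 2 ∂P ≤ 1 / ((k : ℝ) + 1)) :
    ∫ ω, S.err b (fun q => Z q ω) k ∂P ≤ 1 := by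
  have h1 : ∫ ω, S.err b (fun q => Z q ω) k ∂P
      ≤ ∫ ω, (S.err b (fun q => Z q ω) k ^ 2 + 1) / 2 ∂P :=
    integral_mono ((S.finDep_err b k).integrable hZ.measurable)
      (((S.finDep_err b k).comp fun e => (e ^ 2 + 1) / 2).integrable hZ.measurable) fun ω => by
      dsimp only
      nlinarith [sq_nonneg (S.err b (fun q => Z q ω) k - 1)]
  rw [integral_div, integral_add (((S.finDep_err b k).comp fun e => e ^ 2).integrable
    hZ.measurable) (integrable_const _)] at h1
  simp only [integral_const, probReal_univ, one_smul] at h1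
  have h2 : 1 / ((k : ℝ) + 1) ≤ 1 := by
    rw [div_le_one (by positivity)]
    linarith [Nat.cast_nonneg (α := ℝ) k]
  linarith

/-- The second entry of `D` is tailored to this induction. The bound at `k` controls the inner gaps,
these make the mean errors at most `1`, and the recursion for the dual distance returns at most `D`,
uniformly in `k`. -/
theorem integral_dualDist_le (hS : S.Admissible) (hZ : UniformDraws P S.I S.J Z) (k : ℕ) (b : Bool) :
    ∫ ω, S.dualDist b (fun q => Z q ω) k ∂P ≤ S.D b := by
  induction k generalizing b with
  | zero =>
    have : ∀ ω, S.dualDist b (fun q => Z q ω) 0 = S.distLam b S.w0 (S.lam0 b) := fun _ => rfl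
    simp_rw [this]
    rw [integral_const, probReal_univ, one_smul]
    exact le_max_left _ _
  | succ k ih =>
    have hgap := fun b => hS.integral_outGap_le hZ b k (ih b)
    have herr := fun b => integral_err_le_one hZ b k
      (hS.integral_err_sq_le_of_outGap hZ b k (hgap b))
    have hδ := sub_pos.2 hS.rho_lt
    have hμ := hS.mu_pos
    have hγ := hS.gamma_pos
    have hB := hS.smooth.B_nonneg
    have hc : 0 < 1 - S.μ * S.ρ := by linarith [hS.mu_mul_rho_lt]
    have ie : ∀ b, Integrable (fun ω => S.err b (fun q => Z q ω) k) P := fun b =>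
      (S.finDep_err b k).integrable hZ.measurable
    have ig : Integrable (fun ω => S.outGap b (fun q => Z q ω) k) P :=
      (S.finDep_outGap b k).integrable hZ.measurable
    have i0 : Integrable (fun ω => S.err false (fun q => Z q ω) k
        + S.err true (fun q => Z q ω) k) P := (ie false).add (ie true)
    have i1 : Integrable (fun ω => S.err false (fun q => Z q ω) k + S.err true (fun q => Z q ω) k
        + (S.μ * (Np * S.m * S.B) + S.μ * (Np * S.n * S.B))) P := i0.add (integrable_const _)
    have i2 : Integrable (fun ω => S.err b (fun q => Z q ω) k + 1 / (1 - S.μ * S.ρ) *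
        (S.γ * S.μ⁻¹ * (S.err false (fun q => Z q ω) k + S.err true (fun q => Z q ω) k
          + (S.μ * (Np * S.m * S.B) + S.μ * (Np * S.n * S.B))))) P :=
      (ie b).add ((i1.const_mul _).const_mul _)
    have h1 := integral_mono ((S.finDep_dualDist b (k + 1)).integrable hZ.measurable)
      (ig.add (i2.const_mul (Np * S.B))) fun ω => hS.dualDist_succ_le b (fun q => Z q ω) k
    have e1 : ∫ ω, (S.outGap b (fun q => Z q ω) k + Np * S.B * (S.err b (fun q => Z q ω) k
        + 1 / (1 - S.μ * S.ρ) * (S.γ * S.μ⁻¹ * (S.err false (fun q => Z q ω) k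
          + S.err true (fun q => Z q ω) k
          + (S.μ * (Np * S.m * S.B) + S.μ * (Np * S.n * S.B)))))) ∂P
        = ∫ ω, S.outGap b (fun q => Z q ω) k ∂P + Np * S.B * (∫ ω, S.err b (fun q => Z q ω) k ∂P
        + 1 / (1 - S.μ * S.ρ) * (S.γ * S.μ⁻¹ * (∫ ω, S.err false (fun q => Z q ω) k ∂P
          + ∫ ω, S.err true (fun q => Z q ω) k ∂P
          + (S.μ * (Np * S.m * S.B) + S.μ * (Np * S.n * S.B))))) := by
      rw [integral_add ig (i2.const_mul _), integral_const_mul,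
        integral_add (ie b) ((i1.const_mul _).const_mul _), integral_const_mul, integral_const_mul,
        integral_add i0 (integrable_const _), integral_add (ie false) (ie true)]
      simp
    refine h1.trans ((le_of_eq e1).trans (le_trans ?_ (le_max_right _ _)))
    have h2 : (S.μ⁻¹ - S.ρ) / (2 * (k + 1)) ≤ 1 / 2 * (1 / S.μ - S.ρ) := by
      rw [div_le_iff₀ (by positivity), one_div S.μ]
      nlinarith [Nat.cast_nonneg (α := ℝ) k]
    have h3 : Np * S.B * (∫ ω, S.err b (fun q => Z q ω) k ∂P
        + 1 / (1 - S.μ * S.ρ) * (S.γ * S.μ⁻¹ * (∫ ω, S.err false (fun q => Z q ω) k ∂P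
          + ∫ ω, S.err true (fun q => Z q ω) k ∂P
          + (S.μ * (Np * S.m * S.B) + S.μ * (Np * S.n * S.B)))))
        ≤ Np * S.B * (1 + 1 / (1 - S.μ * S.ρ) * (S.γ * S.μ⁻¹ * (1 + 1
          + (S.μ * (Np * S.m * S.B) + S.μ * (Np * S.n * S.B))))) := by
      have := herr b
      have := herr false
      have := herr true
      gcongr
    have h4 : Np * S.B * (1 + 1 / (1 - S.μ * S.ρ) * (S.γ * S.μ⁻¹ * (1 + 1
          + (S.μ * (Np * S.m * S.B) + S.μ * (Np * S.n * S.B)))))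
        = Np * S.B + Np * S.B / (1 - S.μ * S.ρ)
        * (2 * S.γ / S.μ + S.γ * (Np * S.n * S.B) + S.γ * (Np * S.m * S.B)) := by
      field_simp
      ring
    have h5 : 0 ≤ S.μ * (Np * S.lev b * S.B) ^ 2 / 2 := by positivity
    linarith [hgap b]

theorem integral_err_sq_le (hS : S.Admissible) (hZ : UniformDraws P S.I S.J Z) (b : Bool) (k : ℕ) :
    ∫ ω, S.err b (fun q => Z q ω) k ^ 2 ∂P ≤ 1 / ((k : ℝ) + 1) :=
  hS.integral_err_sq_le_of_outGap hZ b k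
    (hS.integral_outGap_le hZ b k (hS.integral_dualDist_le hZ k b))

end Setup.Admissible

/-! ### Inexact gradient descent on the difference of the Moreau envelopes. -/

/-- The smoothed objective `F^μ`. -/
def Setup.smoothObj {d Np Nm : ℕ} (S : Setup d Np Nm) (w : Vec d) : ℝ :=
  env S.μ (fTop S.s S.n) w - env S.μ (fTop S.s S.m) w

/-- The gradient of the smoothed objective. -/
def Setup.smoothGrad {d Np Nm : ℕ} (S : Setup d Np Nm) (w : Vec d) : Vec d :=
  S.μ⁻¹ • (S.proxL false w - S.proxL true w)

namespace Setup.Admissible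

variable {d Np Nm : ℕ} {S : Setup d Np Nm} {Ω : Type*} [MeasurableSpace Ω] {P : Measure Ω}
  [IsProbabilityMeasure P] {Z : ℕ × Bool × ℕ → Ω → Sample Np Nm}

/-- With the proximal point of `f^n` as a competitor in the envelope of `f^m`, the quadratic terms
cancel and a value of `F` remains. -/
theorem Fstar_le_smoothObj (hS : S.Admissible) (w : Vec d) :
    Fstar S.s S.m S.n ≤ S.smoothObj w := by
  have h1 : Fstar S.s S.m S.n ≤ objF S.s S.m S.n (S.proxL true w) :=
    ciInf_le hS.smooth.bddBelow _
  have h2 := (hS.wcl false).isProx_prox hS.mu_pos w (S.proxL true w)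
  have h3 : S.smoothObj w = fTop S.s S.n (S.proxL true w)
      + ‖S.proxL true w - w‖ ^ 2 / (2 * S.μ) - (fTop S.s S.m (prox S.μ (fTop S.s S.m) w)
        + ‖prox S.μ (fTop S.s S.m) w - w‖ ^ 2 / (2 * S.μ)) := rfl
  rw [h3]
  simp only [lev, Bool.false_eq_true, if_false] at h2
  unfold objF at h1
  linarith

/-- The same comparison with the roles exchanged; it explains why `outerBound` contains `F` at the
proximal point of `f^m`. -/
theorem smoothObj_le (hS : S.Admissible) (w : Vec d) :
    S.smoothObj w ≤ objF S.s S.m S.n (S.proxL false w) := by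
  have h2 := (hS.wcl true).isProx_prox hS.mu_pos w (S.proxL false w)
  have h3 : S.smoothObj w = fTop S.s S.n (prox S.μ (fTop S.s S.n) w)
      + ‖prox S.μ (fTop S.s S.n) w - w‖ ^ 2 / (2 * S.μ) - (fTop S.s S.m (S.proxL false w)
        + ‖S.proxL false w - w‖ ^ 2 / (2 * S.μ)) := rfl
  rw [h3]
  simp only [lev, if_true] at h2
  unfold objF
  linarith

/-- The upper quadratic bound serves the envelope of `f^n`, the lower one that of `f^m`, which
enters with a minus sign. -/
theorem smoothObj_descent (hS : S.Admissible) (w w' : Vec d) :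
    S.smoothObj w' ≤ S.smoothObj w + inner ℝ (S.smoothGrad w) (w' - w)
      + (S.μ⁻¹ + S.ρ / (1 - S.μ * S.ρ)) / 2 * ‖w' - w‖ ^ 2 := by
  have h1 := (hS.wcl true).env_le_add hS.mu_pos w w'
  have h2 := (hS.wcl false).le_env hS.mu_pos hS.rho_lt w w'
  have h3 : inner ℝ (S.smoothGrad w) (w' - w) = inner ℝ (w - S.proxL true w) (w' - w) / S.μ
      - inner ℝ (w - S.proxL false w) (w' - w) / S.μ := by
    rw [smoothGrad, real_inner_smul_left, ← sub_div, ← inner_sub_left, inv_mul_eq_div]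
    congr 2
    abel
  have h4 : ‖w' - w‖ ^ 2 / (2 * S.μ) = S.μ⁻¹ / 2 * ‖w' - w‖ ^ 2 := by
    have := hS.mu_pos
    field_simp
  rw [h3]
  rw [h4] at h1
  simp only [lev, if_true] at h1
  simp only [lev, Bool.false_eq_true, if_false] at h2
  simp only [smoothObj, proxL, lev, if_true, Bool.false_eq_true, if_false]
  linarith

/-- The step is `-γ (A + e)` with exact gradient `A` and error `e`. By the bound on `γ`, the
decrease is governed by `-⟨A, A + e⟩ + ‖A + e‖² / 2 = (‖e‖² - ‖A‖²) / 2`. -/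
theorem smoothObj_agd_succ_le (hS : S.Admissible) (z : ℕ × Bool × ℕ → Sample Np Nm) (k : ℕ) :
    S.smoothObj (S.agd z (k + 1)).1 + S.γ / 2 * ‖S.smoothGrad (S.agd z k).1‖ ^ 2
      ≤ S.smoothObj (S.agd z k).1
        + S.γ * (S.μ⁻¹ ^ 2 * (S.err false z k ^ 2 + S.err true z k ^ 2)) := by
  have h1 := hS.smoothObj_descent (S.agd z k).1 (S.agd z (k + 1)).1
  have hγ := hS.gamma_pos
  set A := S.smoothGrad (S.agd z k).1 with hA
  set p := (S.out false z k).1 - S.proxL false (S.agd z k).1 with hp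
  set q := (S.out true z k).1 - S.proxL true (S.agd z k).1 with hq
  set e := S.μ⁻¹ • (p - q) with he
  have h2 : (S.agd z (k + 1)).1 - (S.agd z k).1 = -(S.γ • (A + e)) := by
    rw [Setup.agd_succ, he, hA, hp, hq, smoothGrad]
    module
  have h3 : ‖e‖ ^ 2 ≤ 2 * (S.μ⁻¹ ^ 2 * (S.err false z k ^ 2 + S.err true z k ^ 2)) := by
    have h4 : ‖p - q‖ ^ 2 ≤ 2 * (‖p‖ ^ 2 + ‖q‖ ^ 2) := by
      have := parallelogram_law_with_norm ℝ p q
      nlinarith [sq_nonneg ‖p + q‖]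
    rw [he, norm_smul, mul_pow, Real.norm_eq_abs, sq_abs]
    have := mul_le_mul_of_nonneg_left h4 (sq_nonneg S.μ⁻¹)
    simp only [err]
    linarith
  rw [h2, inner_neg_right, inner_smul_right, norm_neg, norm_smul, Real.norm_eq_abs,
    abs_of_pos hγ, inner_add_right, real_inner_self_eq_norm_sq] at h1
  have h5 := norm_add_sq_real A e
  have h6 := mul_le_mul_of_nonneg_right hS.gamma_mul_le
    (by positivity : 0 ≤ S.γ / 2 * ‖A + e‖ ^ 2)
  have h7 := mul_le_mul_of_nonneg_left h3 (half_pos hγ).le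
  rw [h5] at h6
  rw [mul_pow, h5] at h1
  linarith

theorem sum_integral_smoothGrad_sq_le (hS : S.Admissible) (hZ : UniformDraws P S.I S.J Z) (K : ℕ) :
    S.γ / 2 * ∑ k ∈ Finset.range K, ∫ ω, ‖S.smoothGrad (S.agd (fun q => Z q ω) k).1‖ ^ 2 ∂P
      ≤ objF S.s S.m S.n (S.proxL false S.w0) - Fstar S.s S.m S.n
        + 2 * S.γ * S.μ⁻¹ ^ 2 * ∑ k ∈ Finset.range K, 1 / ((k : ℝ) + 1) := by
  have iF : ∀ k, Integrable (fun ω => S.smoothObj (S.agd (fun q => Z q ω) k).1) P := fun k =>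
    ((S.finDep_state k).comp fun p => S.smoothObj p.1.1).integrable hZ.measurable
  have iG : ∀ k, Integrable (fun ω => ‖S.smoothGrad (S.agd (fun q => Z q ω) k).1‖ ^ 2) P :=
    fun k => ((S.finDep_state k).comp fun p => ‖S.smoothGrad p.1.1‖ ^ 2).integrable hZ.measurable
  have ie : ∀ b k, Integrable (fun ω => S.err b (fun q => Z q ω) k ^ 2) P := fun b k =>
    ((S.finDep_err b k).comp fun e => e ^ 2).integrable hZ.measurable
  have hγ := hS.gamma_pos
  have hone : ∀ k, ∫ ω, S.smoothObj (S.agd (fun q => Z q ω) (k + 1)).1 ∂P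
      + S.γ / 2 * ∫ ω, ‖S.smoothGrad (S.agd (fun q => Z q ω) k).1‖ ^ 2 ∂P
      ≤ ∫ ω, S.smoothObj (S.agd (fun q => Z q ω) k).1 ∂P
        + 2 * S.γ * S.μ⁻¹ ^ 2 * (1 / ((k : ℝ) + 1)) := by
    intro k
    have i0 : Integrable (fun ω => S.err false (fun q => Z q ω) k ^ 2
        + S.err true (fun q => Z q ω) k ^ 2) P := (ie false k).add (ie true k)
    have h := integral_mono ((iF (k + 1)).add ((iG k).const_mul (S.γ / 2)))
      ((iF k).add ((i0.const_mul (S.μ⁻¹ ^ 2)).const_mul S.γ))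
      fun ω => hS.smoothObj_agd_succ_le (fun q => Z q ω) k
    simp only [Pi.add_apply] at h
    rw [integral_add (iF (k + 1)) ((iG k).const_mul (S.γ / 2)), integral_const_mul,
      integral_add (iF k) ((i0.const_mul (S.μ⁻¹ ^ 2)).const_mul S.γ),
      integral_const_mul, integral_const_mul, integral_add (ie false k) (ie true k)] at h
    have h1 := hS.integral_err_sq_le hZ false k
    have h2 := hS.integral_err_sq_le hZ true k
    have h3 := mul_le_mul_of_nonneg_left (add_le_add h1 h2)
      (by positivity : 0 ≤ S.γ * S.μ⁻¹ ^ 2)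
    linarith
  have hsum : ∫ ω, S.smoothObj (S.agd (fun q => Z q ω) K).1 ∂P
      + S.γ / 2 * ∑ k ∈ Finset.range K, ∫ ω, ‖S.smoothGrad (S.agd (fun q => Z q ω) k).1‖ ^ 2 ∂P
      ≤ S.smoothObj S.w0 + 2 * S.γ * S.μ⁻¹ ^ 2 * ∑ k ∈ Finset.range K, 1 / ((k : ℝ) + 1) := by
    induction K with
    | zero =>
      have : ∀ ω, S.smoothObj (S.agd (fun q => Z q ω) 0).1 = S.smoothObj S.w0 := fun _ => rfl
      simp [this]
    | succ K ih =>
      rw [Finset.sum_range_succ, Finset.sum_range_succ, mul_add, mul_add]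
      linarith [hone K]
  have h1 : Fstar S.s S.m S.n ≤ ∫ ω, S.smoothObj (S.agd (fun q => Z q ω) K).1 ∂P := by
    have := integral_mono (integrable_const (μ := P) (Fstar S.s S.m S.n)) (iF K)
      fun ω => hS.Fstar_le_smoothObj _
    simpa using this
  linarith [hS.smoothObj_le S.w0]

end Setup.Admissible

/-! ### The complexity bounds -/

theorem sum_one_div_le_one_add_log (K : ℕ) :
    ∑ k ∈ Finset.range K, 1 / ((k : ℝ) + 1) ≤ 1 + Real.log K := by
  refine le_trans (le_of_eq ?_) (harmonic_le_one_add_log K)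
  simp [harmonic]

/-- Combine `log (x / a) ≤ x / a - 1` with `log a ≤ x / a`. It applies to every `K` beyond the
threshold `a * log a`. -/
theorem one_add_log_le {a x : ℝ} (ha : 0 < a) (hx : 0 < x) (h : a * Real.log a ≤ x) :
    1 + Real.log x ≤ 2 * x / a := by
  have h1 := Real.log_le_sub_one_of_pos (div_pos hx ha)
  rw [Real.log_div hx.ne' ha.ne'] at h1
  have h2 : Real.log a ≤ x / a := by rwa [le_div_iff₀ ha, mul_comm]
  rw [mul_div_assoc]
  linarith

namespace Setup.Admissible

variable {d Np Nm : ℕ} {S : Setup d Np Nm} {Ω : Type*} [MeasurableSpace Ω] {P : Measure Ω}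
  [IsProbabilityMeasure P] {Z : ℕ × Bool × ℕ → Ω → Sample Np Nm} {ε : ℝ} {K : ℕ}

/-- With `a = 96 / (q ε²)` and `q = min 1 (μ²)`, the harmonic average is at most `(1 + log K) / K ≤
2 / a`. -/
theorem harmonic_average_le (hS : S.Admissible) (hε : 0 < ε) (hK : S.outerIters ε ≤ K) :
    1 / (K : ℝ) * ∑ k ∈ Finset.range K, 1 / ((k : ℝ) + 1) ≤ min 1 (S.μ ^ 2) * ε ^ 2 / 48 := by
  have hμ := hS.mu_pos
  have hq : 0 < min 1 (S.μ ^ 2) := lt_min one_pos (by positivity)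
  have hKpos : (0 : ℝ) < K := by exact_mod_cast (le_max_left 1 _).trans hK
  have h1 : S.outerBound ε ≤ K :=
    (Nat.le_ceil _).trans (by exact_mod_cast (le_max_right 1 _).trans hK)
  have h2 := one_add_log_le (by positivity) hKpos ((le_max_right _ _).trans h1)
  have h3 := (sum_one_div_le_one_add_log K).trans h2
  rw [one_div_mul_eq_div, div_le_iff₀ hKpos]
  refine h3.trans (le_of_eq ?_)
  field_simp
  norm_num

/-- In units of `q ε² / μ²` with `q = min 1 (μ²)`, the initial gap contributes `1/8` and the inner
errors `1/12`, together less than `1/4`. -/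
theorem smoothGrad_sq_average_le (hS : S.Admissible) (hZ : UniformDraws P S.I S.J Z) (hε : 0 < ε)
    (hK : S.outerIters ε ≤ K) :
    1 / (K : ℝ) * ∑ k ∈ Finset.range K, ∫ ω, ‖S.smoothGrad (S.agd (fun q => Z q ω) k).1‖ ^ 2 ∂P
      ≤ min 1 (S.μ ^ 2) * ε ^ 2 / (4 * S.μ ^ 2) := by
  have hμ := hS.mu_pos
  have hγ := hS.gamma_pos
  have hq : 0 < min 1 (S.μ ^ 2) := lt_min one_pos (by positivity)
  have hKpos : (0 : ℝ) < K := by exact_mod_cast (le_max_left 1 _).trans hK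
  have h1 : S.outerBound ε ≤ K :=
    (Nat.le_ceil _).trans (by exact_mod_cast (le_max_right 1 _).trans hK)
  have h2 := (le_max_left _ _).trans h1
  rw [div_mul_eq_mul_div, div_le_iff₀ (by positivity)] at h2
  have h3 := hS.sum_integral_smoothGrad_sq_le hZ K
  have h4 := hS.harmonic_average_le hε hK
  set H := ∑ k ∈ Finset.range K, 1 / ((k : ℝ) + 1)
  set G := ∑ k ∈ Finset.range K, ∫ ω, ‖S.smoothGrad (S.agd (fun q => Z q ω) k).1‖ ^ 2 ∂P
  set Δ := objF S.s S.m S.n (S.proxL false S.w0) - Fstar S.s S.m S.n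
  set q := min 1 (S.μ ^ 2)
  rw [one_div_mul_eq_div, div_le_iff₀ hKpos] at h4 ⊢
  have h5 : Δ ≤ S.γ / 2 * (q * ε ^ 2 / (8 * S.μ ^ 2) * K) := by
    rw [show S.γ / 2 * (q * ε ^ 2 / (8 * S.μ ^ 2) * K)
      = K * (S.γ * q * ε ^ 2) / (16 * S.μ ^ 2) by field_simp; norm_num,
      le_div_iff₀ (by positivity)]
    linarith
  have h6 : 2 * S.γ * S.μ⁻¹ ^ 2 * H ≤ S.γ / 2 * (q * ε ^ 2 / (12 * S.μ ^ 2) * K) := by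
    refine (mul_le_mul_of_nonneg_left h4 (by positivity)).trans (le_of_eq ?_)
    field_simp
    norm_num
  have h7 : q * ε ^ 2 / (8 * S.μ ^ 2) * K + q * ε ^ 2 / (12 * S.μ ^ 2) * K
      ≤ q * ε ^ 2 / (4 * S.μ ^ 2) * K := by
    rw [← add_mul]
    refine mul_le_mul_of_nonneg_right ?_ hKpos.le
    have : q * ε ^ 2 / (4 * S.μ ^ 2) - (q * ε ^ 2 / (8 * S.μ ^ 2) + q * ε ^ 2 / (12 * S.μ ^ 2))
        = q * ε ^ 2 / (24 * S.μ ^ 2) := by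
      field_simp
      norm_num
    have : 0 ≤ q * ε ^ 2 / (24 * S.μ ^ 2) := by positivity
    linarith
  refine le_of_mul_le_mul_left ?_ (half_pos hγ)
  have h8 := mul_le_mul_of_nonneg_left h7 (half_pos hγ).le
  linarith

/-- Integrate and average `x ≤ x² / (2 c) + c / 2`. -/
theorem _root_.PAUC.average_le_of_average_sq_le {f : ℕ → (ℕ × Bool × ℕ → Sample Np Nm) → ℝ}
    (hf : ∀ k, FinDep (f k)) (hZ : ∀ q, Measurable (Z q)) (hK : 1 ≤ K) {c : ℝ} (hc : 0 < c)
    (h : 1 / (K : ℝ) * ∑ k ∈ Finset.range K, ∫ ω, f k (fun q => Z q ω) ^ 2 ∂P ≤ c ^ 2) :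
    1 / (K : ℝ) * ∑ k ∈ Finset.range K, ∫ ω, f k (fun q => Z q ω) ∂P ≤ c := by
  have hKpos : (0 : ℝ) < K := by exact_mod_cast hK
  have h1 : ∀ k, ∫ ω, f k (fun q => Z q ω) ∂P
      ≤ 1 / (2 * c) * ∫ ω, f k (fun q => Z q ω) ^ 2 ∂P + c / 2 := by
    intro k
    have i2 : Integrable (fun ω => f k (fun q => Z q ω) ^ 2) P :=
      ((hf k).comp fun x => x ^ 2).integrable hZ
    have h2 := integral_mono ((hf k).integrable (P := P) hZ)
      ((i2.const_mul (1 / (2 * c))).add (integrable_const (c / 2))) fun ω => by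
        have h3 : 0 ≤ (f k (fun q => Z q ω) - c) ^ 2 / (2 * c) := by positivity
        have h4 : (f k (fun q => Z q ω) - c) ^ 2 / (2 * c)
            = 1 / (2 * c) * f k (fun q => Z q ω) ^ 2 + c / 2 - f k (fun q => Z q ω) := by
          field_simp
          ring
        simp only [Pi.add_apply]
        linarith
    simp only [Pi.add_apply] at h2
    rw [integral_add (i2.const_mul _) (integrable_const _), integral_const_mul] at h2
    simpa using h2
  have h2 := Finset.sum_le_sum fun k (_ : k ∈ Finset.range K) => h1 k
  rw [Finset.sum_add_distrib, ← Finset.mul_sum, Finset.sum_const, Finset.card_range,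
    nsmul_eq_mul] at h2
  rw [one_div_mul_eq_div, div_le_iff₀ hKpos] at h ⊢
  have h3 := mul_le_mul_of_nonneg_left h (by positivity : 0 ≤ 1 / (2 * c))
  have h4 : 1 / (2 * c) * (c ^ 2 * K) = K * (c / 2) := by field_simp
  linarith

/-- The witnesses are the gradient of `F^μ` and the exact proximal points of `f^n` and `f^m` at the
random iterate. Since `μ` times the gradient is the difference of these points, the last distance is
at most `ε / 4` (inner error) plus `ε / 2` in mean. The factor `min 1 (μ²)` serves the gradient and
its multiple by `μ` at once. -/
theorem nearlyCritical (hS : S.Admissible) (hZ : UniformDraws P S.I S.J Z) (hε : 0 < ε)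
    (hK : S.outerIters ε ≤ K) {κ : Ω → ℕ} (hκ : UniformIndex P Z K κ) :
    NearlyCritical P (fTop S.s S.n) (fTop S.s S.m) ε
      (fun ω => S.vbar true (fun q => Z q ω) (κ ω)) := by
  have hK1 : 1 ≤ K := (le_max_left 1 _).trans hK
  have hμ := hS.mu_pos
  have hq : 0 < min 1 (S.μ ^ 2) := lt_min one_pos (by positivity)
  have fG : ∀ k, FinDep fun z : ℕ × Bool × ℕ → Sample Np Nm => S.smoothGrad (S.agd z k).1 :=
    fun k => (S.finDep_state k).comp fun p => S.smoothGrad p.1.1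
  have fE : ∀ b k, FinDep fun z : ℕ × Bool × ℕ → Sample Np Nm =>
      (S.out true z k).1 - S.proxL b (S.agd z k).1 :=
    fun b k => (S.finDep_state k).comp fun p => (p.2 true).1 - S.proxL b p.1.1
  have hGsq := hS.smoothGrad_sq_average_le hZ hε hK
  have hG : 1 / (K : ℝ) * ∑ k ∈ Finset.range K,
      ∫ ω, ‖S.smoothGrad (S.agd (fun q => Z q ω) k).1‖ ∂P ≤ ε / 2 := by
    refine average_le_of_average_sq_le (fun k => (fG k).comp fun x => ‖x‖) hZ.measurable hK1
      (half_pos hε) (hGsq.trans ?_)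
    rw [div_le_iff₀ (by positivity)]
    nlinarith [mul_le_mul_of_nonneg_right (min_le_right 1 (S.μ ^ 2)) (sq_nonneg ε)]
  have hμG : 1 / (K : ℝ) * ∑ k ∈ Finset.range K,
      ∫ ω, S.μ * ‖S.smoothGrad (S.agd (fun q => Z q ω) k).1‖ ∂P ≤ ε / 2 := by
    refine average_le_of_average_sq_le (fun k => (fG k).comp fun x => S.μ * ‖x‖) hZ.measurable hK1
      (half_pos hε) ?_
    simp only [mul_pow, integral_const_mul, ← Finset.mul_sum]
    have h1 := mul_le_mul_of_nonneg_left hGsq (sq_nonneg S.μ)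
    have h2 : S.μ ^ 2 * (min 1 (S.μ ^ 2) * ε ^ 2 / (4 * S.μ ^ 2)) = min 1 (S.μ ^ 2) * (ε / 2) ^ 2 := by
      field_simp
      norm_num
    have h3 := mul_le_mul_of_nonneg_right (min_le_left 1 (S.μ ^ 2)) (sq_nonneg (ε / 2))
    linarith
  have hE : 1 / (K : ℝ) * ∑ k ∈ Finset.range K, ∫ ω, S.err true (fun q => Z q ω) k ∂P ≤ ε / 4 := by
    refine average_le_of_average_sq_le (fun k => S.finDep_err true k) hZ.measurable hK1
      (by positivity) ?_
    have h1 : ∑ k ∈ Finset.range K, ∫ ω, S.err true (fun q => Z q ω) k ^ 2 ∂P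
        ≤ ∑ k ∈ Finset.range K, 1 / ((k : ℝ) + 1) :=
      Finset.sum_le_sum fun k _ => hS.integral_err_sq_le hZ true k
    have h2 := mul_le_mul_of_nonneg_left h1 (by positivity : 0 ≤ 1 / (K : ℝ))
    have h3 := hS.harmonic_average_le hε hK
    have h4 := mul_le_mul_of_nonneg_right (min_le_left 1 (S.μ ^ 2)) (sq_nonneg ε)
    nlinarith [sq_nonneg ε]
  refine ⟨fun ω => S.smoothGrad (S.agd (fun q => Z q ω) (κ ω)).1,
    fun ω => S.proxL true (S.agd (fun q => Z q ω) (κ ω)).1,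
    fun ω => S.proxL false (S.agd (fun q => Z q ω) (κ ω)).1,
    Eventually.of_forall fun ω => ⟨_, (hS.wcl true).mem_subdiff hμ _, _,
      (hS.wcl false).mem_subdiff hμ (S.agd (fun q => Z q ω) (κ ω)).1, ?_⟩,
    hκ.integrable hK1 fun k => (fG k).integrable hZ.measurable,
    hκ.integrable hK1 fun k => (fE true k).integrable hZ.measurable,
    hκ.integrable hK1 fun k => (fE false k).integrable hZ.measurable, ?_, ?_, ?_⟩
  · simp only [smoothGrad, proxL]
    rw [← smul_sub, sub_sub_sub_cancel_left]
  · rw [hκ.integral_eq hZ.measurable hK1 (Ψ := fun k z => ‖S.smoothGrad (S.agd z k).1‖)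
      fun k => (fG k).comp fun x => ‖x‖]
    linarith
  · have h := hκ.integral_eq hZ.measurable hK1 (Ψ := fun k z => S.err true z k)
      fun k => S.finDep_err true k
    refine h.le.trans ?_
    linarith
  · have h := hκ.integral_eq hZ.measurable hK1
      (Ψ := fun k z => ‖(S.out true z k).1 - S.proxL false (S.agd z k).1‖)
      fun k => (fE false k).comp fun x => ‖x‖
    refine h.le.trans ?_
    have h1 : ∀ k, ∫ ω, ‖(S.out true (fun q => Z q ω) k).1
        - S.proxL false (S.agd (fun q => Z q ω) k).1‖ ∂P
        ≤ ∫ ω, S.err true (fun q => Z q ω) k ∂P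
          + ∫ ω, S.μ * ‖S.smoothGrad (S.agd (fun q => Z q ω) k).1‖ ∂P := by
      intro k
      have i1 := (S.finDep_err true k).integrable (P := P) hZ.measurable
      have i2 : Integrable (fun ω => S.μ * ‖S.smoothGrad (S.agd (fun q => Z q ω) k).1‖) P :=
        ((fG k).comp fun x => S.μ * ‖x‖).integrable hZ.measurable
      rw [← integral_add i1 i2]
      refine integral_mono ((fE false k).integrable hZ.measurable).norm (i1.add i2) fun ω => ?_
      refine (norm_sub_le_norm_sub_add_norm_sub _ (S.proxL true (S.agd (fun q => Z q ω) k).1)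
        _).trans (le_of_eq ?_)
      simp only [err, smoothGrad, norm_smul, Real.norm_eq_abs, abs_inv, abs_of_pos hμ]
      rw [mul_inv_cancel_left₀ hμ.ne', norm_sub_rev (S.proxL true _)]
    have h2 := mul_le_mul_of_nonneg_left
      (Finset.sum_le_sum fun k (_ : k ∈ Finset.range K) => h1 k) (by positivity : 0 ≤ 1 / (K : ℝ))
    rw [Finset.sum_add_distrib, mul_add] at h2
    linarith

/-! ### Growth of the iteration counts. -/

theorem exists_T_bounds (hS : S.Admissible) (b : Bool) : ∃ c C : ℝ, 0 < c ∧ 0 ≤ C ∧ ∀ k : ℕ,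
    c * ((k : ℝ) + 1) ^ 2 ≤ S.T b k ∧ (S.T b k : ℝ) ≤ C * ((k : ℝ) + 1) ^ 2 := by
  have h2 : 0 < S.μ⁻¹ - S.ρ := by linarith [hS.rho_lt]
  have hD := hS.D_pos b
  have hNp := hS.Np_pos
  have hNm := hS.Nm_pos
  have hI := hS.I_pos
  have hμ := hS.mu_pos
  set c₁ : ℝ := 144 * Np ^ 2 * Nm ^ 2 * S.D b ^ 2 / (S.I * (S.μ⁻¹ - S.ρ) ^ 2) with hc₁
  set c₂ : ℝ := 16 * Np ^ 2 * Nm ^ 2 * S.μ ^ 2 * (Np * S.lev b * S.B) ^ 2 * S.B ^ 2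
    / (S.μ⁻¹ - S.ρ) ^ 2 with hc₂
  set c₃ : ℝ := 6 * S.μ * (Np * S.lev b * S.B) ^ 2 / (2 * (S.μ⁻¹ - S.ρ)) with hc₃
  have p1 : 0 < c₁ := by positivity
  have p2 : 0 ≤ c₂ := by positivity
  have p3 : 0 ≤ c₃ := by positivity
  -- The first entry of the maximum has a positive coefficient because `D` is positive. The `+ 1`
  -- pays for the ceiling.
  refine ⟨c₁, c₁ + c₂ + c₃ + 1, p1, by positivity, fun k => ?_⟩
  have e : S.T b k = ⌈max (max (c₁ * ((k : ℝ) + 1) ^ 2) (c₂ * ((k : ℝ) + 1) ^ 2))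
      (c₃ * ((k : ℝ) + 1))⌉₊ := by
    rw [hc₁, hc₂, hc₃, div_mul_eq_mul_div, div_mul_eq_mul_div, div_mul_eq_mul_div]
    rfl
  rw [e]
  refine ⟨((le_max_left _ _).trans (le_max_left _ _)).trans (Nat.le_ceil _), ?_⟩
  have hk : (1 : ℝ) ≤ k + 1 := by linarith [Nat.cast_nonneg (α := ℝ) k]
  have hk2 : (k : ℝ) + 1 ≤ (k + 1) ^ 2 := by nlinarith
  have hk3 : (1 : ℝ) ≤ (k + 1) ^ 2 := hk.trans hk2
  have q1 : 0 ≤ c₁ * ((k : ℝ) + 1) ^ 2 := by positivity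
  have q2 : 0 ≤ c₂ * ((k : ℝ) + 1) ^ 2 := by positivity
  have q3 : c₃ * ((k : ℝ) + 1) ≤ c₃ * ((k : ℝ) + 1) ^ 2 := by gcongr
  have q4 : 0 ≤ c₃ * ((k : ℝ) + 1) ^ 2 := by positivity
  refine (Nat.ceil_lt_add_one (q1.trans ((le_max_left _ _).trans (le_max_left _ _)))).le.trans ?_
  have : max (max (c₁ * ((k : ℝ) + 1) ^ 2) (c₂ * ((k : ℝ) + 1) ^ 2)) (c₃ * ((k : ℝ) + 1))
      ≤ c₁ * ((k : ℝ) + 1) ^ 2 + c₂ * ((k : ℝ) + 1) ^ 2 + c₃ * ((k : ℝ) + 1) ^ 2 :=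
    max_le (max_le (by linarith) (by linarith)) (by linarith)
  linarith

theorem isTheta_T (hS : S.Admissible) (b : Bool) :
    (fun k : ℕ => (S.T b k : ℝ)) =Θ[atTop] fun k : ℕ => ((k : ℝ) + 1) ^ 2 := by
  obtain ⟨c, C, hc, -, h⟩ := hS.exists_T_bounds b
  refine ⟨IsBigO.of_bound C (Eventually.of_forall fun k => ?_),
    IsBigO.of_bound c⁻¹ (Eventually.of_forall fun k => ?_)⟩
  · rw [Real.norm_of_nonneg (by positivity), Real.norm_of_nonneg (by positivity)]
    exact (h k).2
  · rw [Real.norm_of_nonneg (by positivity), Real.norm_of_nonneg (by positivity),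
      inv_mul_eq_div, le_div_iff₀ hc, mul_comm]
    exact (h k).1

theorem isBigO_outerIters (hS : S.Admissible) : (fun ε : ℝ => (S.outerIters ε : ℝ)) =O[𝓝[>] 0]
    fun ε : ℝ => (ε ^ 2)⁻¹ * Real.log (1 / ε) := by
  have hμ := hS.mu_pos
  have hq : 0 < min 1 (S.μ ^ 2) := lt_min one_pos (by positivity)
  set q := min 1 (S.μ ^ 2) with hq'
  set C₁ := 16 * S.μ ^ 2 / (S.γ * q) * (objF S.s S.m S.n (S.proxL false S.w0) - Fstar S.s S.m S.n)
    with hC₁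
  set C₂ := 96 / q with hC₂
  have hC₂pos : 0 < C₂ := by positivity
  refine IsBigO.of_bound (|C₁| + C₂ * (|Real.log C₂| + 2) + 1) ?_
  -- For `ε < 1/e` one has `log (1 / ε) ≥ 1`, so terms of order `1` and `ε⁻²` are absorbed.
  filter_upwards [Ioo_mem_nhdsGT (Real.exp_pos (-1))] with ε hε
  obtain ⟨h0, h1⟩ := hε
  have hl : 1 ≤ Real.log (1 / ε) := by
    rw [one_div, Real.log_inv]
    have := Real.log_lt_log h0 h1
    rw [Real.log_exp] at this
    linarith
  have hε1 : ε ^ 2 ≤ 1 := by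
    have : ε ≤ 1 := h1.le.trans (Real.exp_le_one_iff.2 (by norm_num))
    nlinarith
  have hy : 1 ≤ (ε ^ 2)⁻¹ := (one_le_inv₀ (by positivity)).2 hε1
  have hlog : Real.log (C₂ * (ε ^ 2)⁻¹) = Real.log C₂ + 2 * Real.log (1 / ε) := by
    rw [Real.log_mul hC₂pos.ne' (by positivity), Real.log_inv, Real.log_pow, one_div, Real.log_inv]
    push_cast
    ring
  have hob : S.outerBound ε = max (C₁ * (ε ^ 2)⁻¹)
      (C₂ * (ε ^ 2)⁻¹ * Real.log (C₂ * (ε ^ 2)⁻¹)) := by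
    have e1 : 16 * S.μ ^ 2 / (S.γ * q * ε ^ 2)
        * (objF S.s S.m S.n (S.proxL false S.w0) - Fstar S.s S.m S.n) = C₁ * (ε ^ 2)⁻¹ := by
      rw [hC₁, ← div_div]
      ring
    have e2 : 96 / (q * ε ^ 2) = C₂ * (ε ^ 2)⁻¹ := by
      rw [hC₂, ← div_div, div_eq_mul_inv]
    rw [outerBound, ← hq', e1, e2]
  set ℓ := Real.log (1 / ε)
  set y := (ε ^ 2)⁻¹
  have hyl : 1 ≤ y * ℓ := by nlinarith
  have b1 : C₁ * y ≤ |C₁| * (y * ℓ) := by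
    have h2 : C₁ * y ≤ |C₁| * y := mul_le_mul_of_nonneg_right (le_abs_self _) (by linarith)
    have h3 : |C₁| * y ≤ |C₁| * (y * ℓ) :=
      mul_le_mul_of_nonneg_left (le_mul_of_one_le_right (by linarith) hl) (abs_nonneg _)
    linarith
  have b2 : C₂ * y * Real.log (C₂ * y) ≤ C₂ * (|Real.log C₂| + 2) * (y * ℓ) := by
    rw [hlog, mul_assoc, mul_assoc]
    refine mul_le_mul_of_nonneg_left ?_ hC₂pos.le
    have h2 : Real.log C₂ ≤ |Real.log C₂| * ℓ :=
      (le_abs_self _).trans (le_mul_of_one_le_right (abs_nonneg _) hl)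
    have h3 := mul_le_mul_of_nonneg_left h2 (by linarith : 0 ≤ y)
    linarith
  have p1 : 0 ≤ |C₁| * (y * ℓ) := by positivity
  have p2 : 0 ≤ C₂ * (|Real.log C₂| + 2) * (y * ℓ) := by positivity
  rw [Real.norm_of_nonneg (by positivity), Real.norm_of_nonneg (by linarith)]
  have h4 : (⌈S.outerBound ε⌉₊ : ℝ) ≤ |C₁| * (y * ℓ) + C₂ * (|Real.log C₂| + 2) * (y * ℓ) + 1 := by
    have h5 : S.outerBound ε ≤ |C₁| * (y * ℓ) + C₂ * (|Real.log C₂| + 2) * (y * ℓ) := by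
      rw [hob]
      exact max_le (by linarith) (by linarith)
    exact (Nat.cast_le.2 (Nat.ceil_mono h5)).trans (Nat.ceil_lt_add_one (by linarith)).le
  rw [outerIters, Nat.cast_max, Nat.cast_one]
  exact max_le (by linarith) (by linarith)

/-- Each of the `K` summands is `O(K²)`, so the cube of the bound for `outerIters` applies. -/
theorem isBigO_totalInner (hS : S.Admissible) :
    (fun ε : ℝ => (S.totalInner (S.outerIters ε) : ℝ)) =O[𝓝[>] 0]
      fun ε : ℝ => (ε ^ 6)⁻¹ * Real.log (1 / ε) ^ 3 := by
  obtain ⟨_, C, _, hC, h⟩ := hS.exists_T_bounds false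
  obtain ⟨_, C', _, hC', h'⟩ := hS.exists_T_bounds true
  have hcube : ∀ K : ℕ, (S.totalInner K : ℝ) ≤ (C + C') * (K : ℝ) ^ 3 := by
    intro K
    have h1 : ∀ k ∈ Finset.range K, (S.T false k : ℝ) + S.T true k ≤ (C + C') * (K : ℝ) ^ 2 := by
      intro k hk
      have h2 : (k : ℝ) + 1 ≤ K := by exact_mod_cast Finset.mem_range.1 hk
      have h3 : (C + C') * ((k : ℝ) + 1) ^ 2 ≤ (C + C') * (K : ℝ) ^ 2 := by gcongr
      linarith [(h k).2, (h' k).2]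
    have h4 := Finset.sum_le_sum h1
    rw [Finset.sum_const, Finset.card_range, nsmul_eq_mul] at h4
    unfold totalInner
    push_cast
    linarith
  have h5 : (fun ε : ℝ => (S.totalInner (S.outerIters ε) : ℝ)) =O[𝓝[>] 0]
      fun ε : ℝ => (S.outerIters ε : ℝ) ^ 3 := by
    refine IsBigO.of_bound (C + C') (Eventually.of_forall fun ε => ?_)
    rw [Real.norm_of_nonneg (by positivity), Real.norm_of_nonneg (by positivity)]
    exact hcube _
  refine (h5.trans (hS.isBigO_outerIters.pow 3)).congr_right fun ε => ?_
  rw [mul_pow, inv_pow, ← pow_mul]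

end Setup.Admissible

end PAUC

end

theorem theorem1 {d Np Nm : ℕ} (S : PAUC.Setup d Np Nm)
    (hmn : S.m < S.n) (hn : S.n ≤ Nm)
    (hI : 1 ≤ S.I) (hI' : S.I ≤ Np) (hJ : 1 ≤ S.J) (hJ' : S.J ≤ Nm)
    (hs : PAUC.SmoothLosses S.s S.m S.n S.L S.B)
    (hμ : 0 < S.μ) (hμρ : S.ρ < S.μ⁻¹) (hγ : 0 < S.γ) (hγL : S.γ ≤ 1 / S.Lmu) :
    -- the proximal mappings and the distances in the step sizes are well defined
    (∀ (b : Bool) (w : PAUC.Vec d),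
      (∀ v, PAUC.IsProx S.μ (PAUC.fTop S.s (S.lev b)) w v ↔ v = S.proxL b w) ∧
      (PAUC.lamArgmin S.s (S.lev b) (S.proxL b w)).Nonempty) ∧
    -- the output is nearly `ε`-critical after `outerIters ε` (or more) outer iterations
    (∀ {Ω : Type*} [MeasurableSpace Ω] (P : Measure Ω) [IsProbabilityMeasure P]
      (Z : ℕ × Bool × ℕ → Ω → PAUC.Sample Np Nm), PAUC.UniformDraws P S.I S.J Z →
      ∀ ε : ℝ, 0 < ε → ∀ K : ℕ, S.outerIters ε ≤ K →
      ∀ κ : Ω → ℕ, PAUC.UniformIndex P Z K κ →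
        PAUC.NearlyCritical P (PAUC.fTop S.s S.n) (PAUC.fTop S.s S.m) ε
          (fun ω => S.vbar true (fun q => Z q ω) (κ ω))) ∧
    -- orders of the inner and outer iteration counts
    (∀ b : Bool, (fun k : ℕ => (S.T b k : ℝ)) =Θ[atTop] fun k : ℕ => ((k : ℝ) + 1) ^ 2) ∧
    ((fun ε : ℝ => (S.outerIters ε : ℝ)) =O[𝓝[>] 0]
      fun ε : ℝ => (ε ^ 2)⁻¹ * Real.log (1 / ε)) ∧
    ((fun ε : ℝ => (S.totalInner (S.outerIters ε) : ℝ)) =O[𝓝[>] 0]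
      fun ε : ℝ => (ε ^ 6)⁻¹ * Real.log (1 / ε) ^ 3) := by
  have hS : S.Admissible := ⟨hmn, hn, hI, hI', hJ, hJ', hs, hμ, hμρ, hγ, hγL⟩
  exact ⟨fun b w => ⟨fun v => (hS.wcl b).isProx_iff hμ hμρ w v,
      hs.lamArgmin_nonempty (hS.lev_le b) _⟩,
    fun P _ _ hZ _ hε _ hK _ hκ => hS.nearlyCritical hZ hε hK hκ,
    hS.isTheta_T, hS.isBigO_outerIters, hS.isBigO_totalInner⟩
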